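/- **Equivalence class determination.** There are $m$ hypotheses $[m]$ with a probability distribution $(p_i)_{i\in[m]}$ of the true hypothesis, and a finite set $U$ of $n$ tests with costs $c_e>0$. Under hypothesis $i$ the positive tests are those in $S_i\subseteq U$. Let $Q$ be a partition of $[m]$ into at least two parts, $Q(i)$ the part containing $i$, such that $S_i\neq S_j$ whenever $Q(i)\ne Q(j)$. A policy is a binary decision tree $\mathcal T$ with nodes labelled by tests; hypothesis $i$ traces the root-leaf path that takes the yes-branch at $e\in S_i$ and the no-branch at $e\notin S_i$. After the tests in $X\subseteq U$, the part of $i$ is recognized if every $j$ with $S_j\cap X=S_i\cap X$ lies in $Q(i)$. A policy is feasible if, for every $i$, the part of $i$ is recognized at the end of its path; the cost of $i$ is the cost of the shortest prefix of its path that recognizes its part, and the cost of the policy is the expected cost under $(p_i)$. Put $T_e(i)=\{j\in[m]: e\in S_i\oplus S_j\}$ (with $\oplus$ the symmetric difference) and $$f_i(X)=\frac{\bigl|\bigcup_{e\in X}(T_e(i)\cap Q(i)^c)\bigr|}{|Q(i)^c|}\qquad(X\subseteq U).$$ Consider the following greedy algorithm. Its state is $(E,H)$, where $E$ is the set of performed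 tests and $H$ is the set of hypotheses $i$ compatible with their results and with $f_i(E)<1$. It stops if $H=\emptyset$. Otherwise it performs a test $e\in U\setminus E$ that maximizes $$\frac1{c_e}\Bigl(\sum_{j\in L_e(H)}p_j+\sum_{i\in H}p_i\,\frac{f_i(E\cup\{e\})-f_i(E)}{1-f_i(E)}\Bigr),$$ where $L_e(H)$ is a set of smaller cardinality among $\{i\in H:e\in S_i\}$ and $\{i\in H:e\notin S_i\}$; all ties are broken arbitrarily. Then each $f_i$ is a monotone submodular function with values in $[0,1]$, $f_i(\emptyset)=0$ and $f_i(U)=1$, and $f_i(X)=1$ if and only if the tests in $X$ recognize the part of $i$. Moreover, there is a universal constant $C$ such that, for every instance, every decision tree produced by the greedy algorithm is feasible and its expected cost is at most $C\log m$ times the expected cost of every feasible policy. Finally, with a suitable tie-breaking, a straightforward implementation of the greedy algorithm performs, for every true hypothesis, a number of elementary steps (unit cost model with real arithmetic) bounded by a polynomial in $m+n$. -/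

import Mathlib

open Finset

namespace AdaptiveRanking

/-! ### Adaptive policies -/

/-- Binary decision trees with nodes labelled by elements (tests) of `U`. In `node e yes no` the
element `e` is displayed (the test `e` is performed); the first subtree is followed if the feedback
is positive, the second one if it is negative. -/
inductive DTree (U : Type) : Type
  | leaf : DTree U
  | node : U → DTree U → DTree U → DTree U

/-- The sequence of elements on the root-leaf path traced in a tree by a scenario with
interest set `A`: the yes-branch is taken at `e ∈ A`, the no-branch at `e ∉ A`. -/
def DTree.path {U : Type} [DecidableEq U] (A : Finset U) : DTree U → List U
  | .leaf => []
  | .node e yes no => e :: (if e ∈ A then yes.path A else no.path A)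

/-! ### Adaptive submodular ranking and the greedy algorithm -/

/-- The data of an adaptive submodular ranking problem with elements `Fin n` and scenarios
`Fin m`: interest sets, utility functions, probabilities and costs. -/
structure ASRData (m n : ℕ) where
  S : Fin m → Finset (Fin n)
  f : Fin m → Finset (Fin n) → ℝ
  p : Fin m → ℝ
  c : Fin n → ℝ

/-- The data form an instance of adaptive submodular ranking: every `f i` is a normalized monotone
submodular function with values in `[0,1]`, `p` is a probability distribution, costs are
positive. -/
structure ASRData.IsInstance {m n : ℕ} (A : ASRData m n) : Prop where
  f_mem : ∀ i X, A.f i X ∈ Set.Icc (0 : ℝ) 1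
  f_empty : ∀ i, A.f i ∅ = 0
  f_univ : ∀ i, A.f i Finset.univ = 1
  f_mono : ∀ i X Y, X ⊆ Y → A.f i X ≤ A.f i Y
  f_submodular : ∀ i X Y, A.f i (X ∩ Y) + A.f i (X ∪ Y) ≤ A.f i X + A.f i Y
  p_nonneg : ∀ i, 0 ≤ A.p i
  p_sum : ∑ i, A.p i = 1
  c_pos : ∀ e, 0 < A.c e

namespace ASRData

variable {m n : ℕ} (A : ASRData m n)

/-- The scenarios of `H` with positive feedback on `e`. -/
def yesSide (H : Finset (Fin m)) (e : Fin n) : Finset (Fin m) := {i ∈ H | e ∈ A.S i}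

/-- The scenarios of `H` with negative feedback on `e`. -/
def noSide (H : Finset (Fin m)) (e : Fin n) : Finset (Fin m) := {i ∈ H | e ∉ A.S i}

/-- `L` is a choice of `L_e(H)`: one of the two sides of `H` with respect to `e`, of smallest
cardinality (either side if both have the same cardinality). -/
def IsLight (H : Finset (Fin m)) (e : Fin n) (L : Finset (Fin m)) : Prop :=
  (L = A.yesSide H e ∨ L = A.noSide H e) ∧ #L ≤ #(A.yesSide H e) ∧ #L ≤ #(A.noSide H e)

/-- The score of the element `e` at the state `(E, H)`, where `L` is the choice of `L_e(H)`. -/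
noncomputable def score (E : Finset (Fin n)) (H L : Finset (Fin m)) (e : Fin n) : ℝ :=
  1 / A.c e *
    (∑ j ∈ L, A.p j + ∑ i ∈ H, A.p i * ((A.f i (insert e E) - A.f i E) / (1 - A.f i E)))

/-- At the state `(E, H)` the greedy rule may select `e`: it is an element not displayed so far
that maximizes the score (ties are broken arbitrarily). -/
def IsGreedyChoice (E : Finset (Fin n)) (H : Finset (Fin m)) (e : Fin n) : Prop :=
  ∃ L : Fin n → Finset (Fin m), (∀ e' ∉ E, A.IsLight H e' (L e')) ∧
    e ∉ E ∧ ∀ e' ∉ E, A.score E H (L e') e' ≤ A.score E H (L e) e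

open Classical in
/-- The scenarios of `H` that are not covered by the set `E` of elements. -/
noncomputable def uncovered (E : Finset (Fin n)) (H : Finset (Fin m)) : Finset (Fin m) :=
  {i ∈ H | A.f i E < 1}

/-- `A.GreedyFrom E H T`: the tree `T` is a possible continuation of the greedy algorithm from the
state `(E, H)`, where `E` is the set of displayed elements and `H` is the set of uncovered scenarios
compatible with the feedback. The algorithm stops as soon as `H` is empty. -/
inductive GreedyFrom : Finset (Fin n) → Finset (Fin m) → DTree (Fin n) → Prop
  | finished (E : Finset (Fin n)) : GreedyFrom E ∅ .leaf
  | display (E : Finset (Fin n)) (H : Finset (Fin m)) (e : Fin n) (yes no : DTree (Fin n)) :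
      H.Nonempty → A.IsGreedyChoice E H e →
      GreedyFrom (insert e E) (A.uncovered (insert e E) (A.yesSide H e)) yes →
      GreedyFrom (insert e E) (A.uncovered (insert e E) (A.noSide H e)) no →
      GreedyFrom E H (.node e yes no)

/-- `T` is a decision tree produced by the greedy algorithm (for some way of breaking ties). -/
def IsGreedyTree (T : DTree (Fin n)) : Prop := A.GreedyFrom ∅ (A.uncovered ∅ Finset.univ) T

end ASRData

/-! ### Equivalence class determination -/

/-- An instance of equivalence class determination with hypotheses `Fin m` and tests `Fin n`:
`S i` is the set of tests that are positive under hypothesis `i`, `p` is the distribution of the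
true hypothesis, `c` are the costs of the tests, and `Q` is a partition of the hypotheses whose
parts can be told apart by performing all tests. -/
structure ECD (m n : ℕ) where
  S : Fin m → Finset (Fin n)
  p : Fin m → ℝ
  c : Fin n → ℝ
  Q : Finpartition (Finset.univ : Finset (Fin m))
  p_nonneg : ∀ i, 0 ≤ p i
  p_sum : ∑ i, p i = 1
  c_pos : ∀ e, 0 < c e
  identifiable : ∀ i j, Q.part i ≠ Q.part j → S i ≠ S j

namespace ECD

variable {m n : ℕ} (I : ECD m n)

/-- The hypotheses that have the same results as `i` on all the tests in `E`. -/
def compatible (i : Fin m) (E : Finset (Fin n)) : Finset (Fin m) :=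
  {j | ∀ e ∈ E, (e ∈ I.S j ↔ e ∈ I.S i)}

/-- If `i` is the true hypothesis, the results of the tests in `E` reveal the part of `i`. -/
def Recognized (i : Fin m) (E : Finset (Fin n)) : Prop := I.compatible i E ⊆ I.Q.part i

open Classical in
/-- The cost of the tests that are performed, in the order of the list and after the tests in `E`,
until the part of `i` is recognized (that is, of the shortest prefix of the list that suffices). -/
noncomputable def costUntil (i : Fin m) : Finset (Fin n) → List (Fin n) → ℝ
  | _, [] => 0
  | E, e :: l => if I.Recognized i E then 0 else I.c e + costUntil i (insert e E) l

/-- The policy `T` recognizes the part of the true hypothesis, whatever this hypothesis is. -/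
def Feasible (T : DTree (Fin n)) : Prop := ∀ i, I.Recognized i (T.path (I.S i)).toFinset

/-- The expected cost of the tests performed by the policy `T` until the part containing the true
hypothesis is recognized. -/
noncomputable def expectedCost (T : DTree (Fin n)) : ℝ :=
  ∑ i, I.p i * I.costUntil i ∅ (T.path (I.S i))

/-- `T_e(i)`: the hypotheses whose result on the test `e` differs from that of `i`. -/
def diff (e : Fin n) (i : Fin m) : Finset (Fin m) := {j | e ∈ symmDiff (I.S i) (I.S j)}

/-- The adaptive submodular ranking problem associated with an instance of equivalence class
determination. -/
noncomputable def toASR : ASRData m n where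
  S := I.S
  f i X := (#(X.biUnion fun e => I.diff e i ∩ (I.Q.part i)ᶜ) : ℝ) / (#(I.Q.part i)ᶜ : ℝ)
  p := I.p
  c := I.c

end ECD

/-! ### Step count

The greedy algorithm is written out below with a counter of elementary steps, in the unit cost
model: reading an entry of the input or of an array, an arithmetic operation, a comparison or a
Boolean operation, prepending to a list, performing a test, and starting an iteration of a loop take
one step each. Allocating or copying an array takes as many steps as it has entries. The algorithm
learns about the true hypothesis only through the outcomes of the tests that it performs. -/

/-- A value together with the number of elementary steps spent on computing it. -/
structure Timed (α : Type) where
  val : α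
  steps : ℕ

instance : Monad Timed where
  pure a := ⟨a, 0⟩
  bind x g := ⟨(g x.val).val, x.steps + (g x.val).steps⟩

namespace Timed

/-- One elementary step with result `a`. -/
def op {α : Type} (a : α) : Timed α := ⟨a, 1⟩

/-- A new array with `k` entries equal to `a`. -/
def newArray {α : Type} (k : ℕ) (a : α) : Timed (Fin k → α) := ⟨fun _ => a, k⟩

/-- A copy of an array with one entry changed, at the price of copying the whole array. -/
def copyWith {k : ℕ} {α : Type} (B : Fin k → α) (x : Fin k) (a : α) : Timed (Fin k → α) :=
  ⟨Function.update B x a, k + 1⟩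

/-- Running through a list; every iteration takes one step besides the steps of its body. -/
def loop {ι σ : Type} (body : σ → ι → Timed σ) : List ι → σ → Timed σ
  | [], s => pure s
  | x :: l, s => do
    let s₀ ← op s
    let s₁ ← body s₀ x
    loop body l s₁

end Timed

namespace ECD

open Timed

variable {m n : ℕ} (I : ECD m n)

/-- Reading whether the test `e` is positive under `i`. -/
def readTest (e : Fin n) (i : Fin m) : Timed Bool := op (decide (e ∈ I.S i))

/-- Reading whether `i` and `j` lie in the same part. -/
def readSame (i j : Fin m) : Timed Bool := op (decide (j ∈ I.Q.part i))

/-- Does some test in `E` separate `i` from `j`? -/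
def separatedProg (E : Fin n → Bool) (i j : Fin m) : Timed Bool :=
  loop (fun b e => do
    if ← op (E e) then
      let x ← I.readTest e i
      let y ← I.readTest e j
      let d ← op (x != y)
      op (b || d)
    else pure b) (List.finRange n) false

/-- Computing `f_i(E)`. -/
noncomputable def valueProg (E : Fin n → Bool) (i : Fin m) : Timed ℝ := do
  let s ← loop (fun (s : ℝ × ℝ) j => do
    if ← I.readSame i j then pure s
    else
      let d ← op (s.2 + 1)
      if ← I.separatedProg E i j then
        let a ← op (s.1 + 1)
        pure (a, d)
      else pure (s.1, d)) (List.finRange m) ((0 : ℝ), (0 : ℝ))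
  op (s.1 / s.2)

/-- Computing the probability of `L_e(H)`. The state of the loop consists of the cardinality and
the probability of the yes-side and the cardinality and the probability of the no-side. -/
noncomputable def lightProg (H : Fin m → Bool) (e : Fin n) : Timed ℝ := do
  let s ← loop (fun (s : (ℕ × ℝ) × (ℕ × ℝ)) i => do
    if ← op (H i) then
      let q ← op (I.p i)
      if ← I.readTest e i then
        let k ← op (s.1.1 + 1)
        let r ← op (s.1.2 + q)
        pure ((k, r), s.2)
      else
        let k ← op (s.2.1 + 1)
        let r ← op (s.2.2 + q)
        pure (s.1, (k, r))
    else pure s) (List.finRange m) ((0, (0 : ℝ)), (0, (0 : ℝ)))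
  if ← op (decide (s.1.1 ≤ s.2.1)) then pure s.1.2 else pure s.2.2

/-- Computing the score of `e`. -/
noncomputable def scoreProg (E : Fin n → Bool) (H : Fin m → Bool) (e : Fin n) : Timed ℝ := do
  let light ← I.lightProg H e
  let E' ← copyWith E e true
  let g ← loop (fun (g : ℝ) i => do
    if ← op (H i) then
      let q ← op (I.p i)
      let v ← I.valueProg E i
      let v' ← I.valueProg E' i
      let a ← op (v' - v)
      let b ← op (1 - v)
      let r ← op (a / b)
      let t ← op (q * r)
      op (g + t)
    else pure g) (List.finRange m) (0 : ℝ)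
  let t ← op (light + g)
  let d ← op (I.c e)
  op (t / d)

open Classical in
/-- Selecting the first test outside `E` of maximum score, if there is a test outside `E`. -/
noncomputable def selectProg (E : Fin n → Bool) (H : Fin m → Bool) :
    Timed (Option (Fin n × ℝ)) :=
  loop (fun (best : Option (Fin n × ℝ)) e => do
    if ← op (E e) then pure best
    else
      let s ← I.scoreProg E H e
      match best with
      | none => op (some (e, s))
      | some b => if ← op (decide (b.2 < s)) then op (some (e, s)) else pure best)
    (List.finRange n) none

open Classical in
/-- The set of hypotheses of `H` that give the result `b` on the test `e` and are not covered
by `E`. -/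
noncomputable def updateProg (E : Fin n → Bool) (H : Fin m → Bool) (e : Fin n) (b : Bool) :
    Timed (Fin m → Bool) :=
  loop (fun H' i => do
    let x ← I.readTest e i
    let same ← op (x == b)
    let v ← I.valueProg E i
    let unc ← op (decide (v < 1))
    let h ← op (H i)
    let k ← op (same && unc)
    let k' ← op (h && k)
    copyWith H' i k') (List.finRange m) H

open Classical in
/-- The hypotheses that are not covered by `E`. -/
noncomputable def initProg (E : Fin n → Bool) : Timed (Fin m → Bool) := do
  let H ← newArray m false
  loop (fun H' i => do
    let v ← I.valueProg E i
    let unc ← op (decide (v < 1))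
    copyWith H' i unc) (List.finRange m) H

/-- Is there a hypothesis in `H`? -/
def nonemptyProg (H : Fin m → Bool) : Timed Bool :=
  loop (fun b i => do
    let h ← op (H i)
    op (b || h)) (List.finRange m) false

/-- The adaptive part of the algorithm from the state `(E, H)` on, for at most the given number of
rounds; the outcome of a performed test `e` is `result e`. The output is the list of the tests in
the order in which they are performed. -/
noncomputable def roundsProg (result : Fin n → Bool) :
    ℕ → (Fin n → Bool) → (Fin m → Bool) → Timed (List (Fin n))
  | 0, _, _ => pure []
  | k + 1, E, H => do
    if ← nonemptyProg H then
      match ← I.selectProg E H with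
      | none => pure []
      | some (e, _) =>
        let b ← op (result e)
        let E' ← copyWith E e true
        let H' ← I.updateProg E' H e b
        let l ← roundsProg result k E' H'
        op (e :: l)
    else pure []

/-- The complete run of the greedy algorithm when the tests have the outcomes `result`. -/
noncomputable def greedyProg (result : Fin n → Bool) : Timed (List (Fin n)) := do
  let E ← newArray n false
  let H ← I.initProg E
  I.roundsProg result n E H

end ECD

end AdaptiveRanking

/-! Each `f_i` is a normalized coverage function, so it is monotone and submodular, and its residual
`1 - f_i(E)` is either zero or at least `1 / |Q(i)ᶜ|`.

The cost bound is a charging argument with prices. Write the score of `e` times `c_e` as `∑ i ∈ H,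
p_i * gain_i`, where the gain of `i` is the indicator of `L_e(H)` plus the relative progress of
`f_i`. At a greedy state with maximum score `s`, put `π = p(H) / s`. The expected payment `p(H) *
c_e` then equals `π` times the weighted gain. Along one path, the gains of `i` telescope into
`potential`: each visit to the light side halves `H`, relative progress is bounded by the decrease
of the logarithm of the residual, and the last step adds at most 1. At the root this is at most
`log₂ m + 1 + ln m`. With `M i` the largest price on the path of `i` while `i` is unrecognized, the
greedy cost is at most `∑ p_i * potential_i * M i`.

Prices are compared with a feasible policy `T'` in `mass_le_score_mul_budget`. Follow `T'` always
into the heavy side until a budget `τ` is spent. A hypothesis of `H` with cost at most `τ` under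
`T'` leaves this path on a light side or is recognized by its tests, and in both cases receives
total gain at least 1 from them. As gain per unit cost is at most `s`, such hypotheses have mass at
most `s * τ`. With `τ = t / 2` and `t ≤ π` this is at most half of `p(H)`, so `P(M ≥ t) ≤ 2 * P(2 *
O > t)`, where `O` is the cost under `T'`. Integrating over `t` gives `E[M] ≤ 4 * E[O]`.

For the running time, the values computed by the program are identified with the mathematical ones,
which makes its runs the paths of one greedy tree, and the nested loops are bounded separately. -/

namespace AdaptiveRanking

/-! ### Recognition and the coverage functions `f_i` -/

namespace ECD

variable {m n : ℕ} (I : ECD m n)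

/-- The hypotheses outside the part of `i` that are separated from `i` by the tests in `X`. -/
def separated (i : Fin m) (X : Finset (Fin n)) : Finset (Fin m) :=
  X.biUnion fun e => I.diff e i ∩ (I.Q.part i)ᶜ

theorem mem_separated {i j : Fin m} {X : Finset (Fin n)} :
    j ∈ I.separated i X ↔ j ∉ I.Q.part i ∧ ∃ e ∈ X, ¬(e ∈ I.S j ↔ e ∈ I.S i) := by
  simp only [separated, mem_biUnion, mem_inter, mem_compl, diff, mem_filter, mem_univ, true_and,
    mem_symmDiff]
  constructor
  · rintro ⟨e, he, h, hj⟩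
    exact ⟨hj, e, he, by tauto⟩
  · rintro ⟨hj, e, he, h⟩
    exact ⟨e, he, by tauto, hj⟩

theorem toASR_f (i : Fin m) (X : Finset (Fin n)) :
    I.toASR.f i X = (#(I.separated i X) : ℝ) / (#(I.Q.part i)ᶜ : ℝ) := rfl

theorem separated_subset (i : Fin m) (X : Finset (Fin n)) :
    I.separated i X ⊆ (I.Q.part i)ᶜ := fun j hj => by
  rw [mem_compl]
  exact (I.mem_separated.1 hj).1

theorem separated_mono (i : Fin m) {X Y : Finset (Fin n)} (h : X ⊆ Y) :
    I.separated i X ⊆ I.separated i Y := biUnion_subset_biUnion_of_subset_left _ h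

theorem separated_empty (i : Fin m) : I.separated i ∅ = ∅ := rfl

theorem separated_eq_compl_iff (i : Fin m) (X : Finset (Fin n)) :
    I.separated i X = (I.Q.part i)ᶜ ↔ I.Recognized i X := by
  constructor
  · intro h j hj
    by_contra hjQ
    have hs : j ∈ I.separated i X := by rw [h, mem_compl]; exact hjQ
    obtain ⟨-, e, he, hne⟩ := I.mem_separated.1 hs
    exact hne ((mem_filter.1 hj).2 e he)
  · intro h
    refine (I.separated_subset i X).antisymm fun j hj => I.mem_separated.2 ⟨mem_compl.1 hj, ?_⟩
    by_contra! hcon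
    exact mem_compl.1 hj (h (mem_filter.2 ⟨mem_univ j, hcon⟩))

theorem recognized_mono {i : Fin m} {X Y : Finset (Fin n)} (h : X ⊆ Y) (hX : I.Recognized i X) :
    I.Recognized i Y := fun _ hj =>
  hX (mem_filter.2 ⟨mem_univ _, fun e he => (mem_filter.1 hj).2 e (h he)⟩)

/-- Agreement on all tests means equal sets `S`, and identifiability rules this out across parts. -/
theorem recognized_univ (i : Fin m) : I.Recognized i univ := by
  intro j hj
  have hS : I.S i = I.S j := by
    ext e
    exact ((mem_filter.1 hj).2 e (mem_univ e)).symm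
  have hQ : I.Q.part i = I.Q.part j := by
    by_contra hne
    exact I.identifiable i j hne hS
  rw [hQ]
  exact I.Q.mem_part (mem_univ j)

variable {I}

theorem card_compl_part_pos (hQ : 2 ≤ #I.Q.parts) (i : Fin m) : 0 < #(I.Q.part i)ᶜ := by
  rw [card_pos]
  obtain ⟨P, hP, hne⟩ := exists_mem_ne (by omega : 1 < #I.Q.parts) (I.Q.part i)
  obtain ⟨j, hj⟩ := I.Q.nonempty_of_mem_parts hP
  refine ⟨j, mem_compl.2 fun hji => hne ?_⟩
  exact I.Q.eq_of_mem_parts hP (I.Q.part_mem.2 (mem_univ i)) hj hji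

theorem toASR_f_eq_one_iff (hQ : 2 ≤ #I.Q.parts) (i : Fin m) (X : Finset (Fin n)) :
    I.toASR.f i X = 1 ↔ I.Recognized i X := by
  have hpos : (0 : ℝ) < #(I.Q.part i)ᶜ := by exact_mod_cast card_compl_part_pos hQ i
  rw [toASR_f, div_eq_one_iff_eq hpos.ne', ← I.separated_eq_compl_iff, Nat.cast_inj]
  exact ⟨fun h => eq_of_subset_of_card_le (I.separated_subset i X) h.ge, fun h => by rw [h]⟩

theorem isInstance_toASR (hQ : 2 ≤ #I.Q.parts) : I.toASR.IsInstance where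
  f_mem i X := by
    have hpos : (0 : ℝ) < #(I.Q.part i)ᶜ := by exact_mod_cast card_compl_part_pos hQ i
    refine ⟨by rw [toASR_f]; positivity, ?_⟩
    rw [toASR_f, div_le_one hpos]
    exact_mod_cast card_le_card (I.separated_subset i X)
  f_empty i := by simp [toASR_f, separated_empty]
  f_univ i := (toASR_f_eq_one_iff hQ i univ).2 (I.recognized_univ i)
  f_mono i X Y h := by
    rw [toASR_f, toASR_f]
    gcongr
    exact I.separated_mono i h
  f_submodular i X Y := by
    simp only [toASR_f, ← add_div]
    refine div_le_div_of_nonneg_right ?_ (Nat.cast_nonneg _)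
    have hU : I.separated i (X ∪ Y) = I.separated i X ∪ I.separated i Y := union_biUnion
    -- Only an inclusion: a hypothesis may be separated by different tests in `X` and in `Y`. This
    -- is the direction that submodularity needs.
    have hI : I.separated i (X ∩ Y) ⊆ I.separated i X ∩ I.separated i Y :=
      subset_inter (I.separated_mono i inter_subset_left) (I.separated_mono i inter_subset_right)
    have := card_union_add_card_inter (I.separated i X) (I.separated i Y)
    have := card_le_card hI
    rw [hU]
    norm_cast
    omega
  p_nonneg := I.p_nonneg
  p_sum := I.p_sum
  c_pos := I.c_pos

/-- The residual `1 - f i E` of an unrecognized hypothesis is at least `1 / |Q(i)ᶜ|`. -/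
theorem one_le_card_mul_residual (hQ : 2 ≤ #I.Q.parts) {i : Fin m} {E : Finset (Fin n)}
    (h : I.toASR.f i E < 1) : 1 ≤ (#(I.Q.part i)ᶜ : ℝ) * (1 - I.toASR.f i E) := by
  have hpos : (0 : ℝ) < #(I.Q.part i)ᶜ := by exact_mod_cast card_compl_part_pos hQ i
  rw [toASR_f, div_lt_one hpos] at h
  rw [toASR_f, mul_sub, mul_one, mul_div_cancel₀ _ hpos.ne']
  have h' : #(I.separated i E) + 1 ≤ #(I.Q.part i)ᶜ := by exact_mod_cast h
  have : (#(I.separated i E) : ℝ) + 1 ≤ #(I.Q.part i)ᶜ := by exact_mod_cast h'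
  linarith

theorem not_recognized_of_lt (hQ : 2 ≤ #I.Q.parts) {i : Fin m} {E : Finset (Fin n)}
    (h : I.toASR.f i E < 1) : ¬I.Recognized i E := fun hr =>
  h.ne ((toASR_f_eq_one_iff hQ i E).2 hr)

end ECD

/-! ### Submodular progress and the decomposition of the score into gains -/

namespace ASRData

variable {m n : ℕ} {A : ASRData m n}

/-- By diminishing returns, tests added one at a time contribute no more than each does when added
directly to `E`. -/
theorem IsInstance.residual_le_sum (hA : A.IsInstance) (i : Fin m) (E P : Finset (Fin n)) :
    A.f i (E ∪ P) - A.f i E ≤ ∑ e ∈ P \ E, (A.f i (insert e E) - A.f i E) := by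
  have key : ∀ R : Finset (Fin n), Disjoint R E →
      A.f i (E ∪ R) - A.f i E ≤ ∑ e ∈ R, (A.f i (insert e E) - A.f i E) := by
    intro R
    induction R using Finset.induction_on with
    | empty => intro _; simp
    | insert a R ha ih =>
      intro hd
      rw [disjoint_insert_left] at hd
      rw [sum_insert ha]
      have hsub := hA.f_submodular i (insert a E) (E ∪ R)
      have h1 : insert a E ∩ (E ∪ R) = E := by
        ext x
        simp only [mem_inter, mem_insert, mem_union]
        constructor
        · rintro ⟨rfl | h, h' | h'⟩ <;> first | assumption | exact absurd h' ha
        · exact fun h => ⟨Or.inr h, Or.inl h⟩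
      have h2 : insert a E ∪ (E ∪ R) = E ∪ insert a R := by
        ext x
        simp only [mem_insert, mem_union]
        tauto
      rw [h1, h2] at hsub
      linarith [ih hd.2]
  have := key (P \ E) sdiff_disjoint
  rwa [union_sdiff_self_eq_union] at this

end ASRData

namespace ASRData

variable {m n : ℕ} (A : ASRData m n)

/-- The contribution of the scenario `i` to `c e` times the score of `e`, relative to `p i`. -/
noncomputable def gain (E : Finset (Fin n)) (L : Finset (Fin m)) (e : Fin n) (i : Fin m) : ℝ :=
  (if i ∈ L then 1 else 0) + (A.f i (insert e E) - A.f i E) / (1 - A.f i E)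

variable {A}

theorem yesSide_subset (H : Finset (Fin m)) (e : Fin n) : A.yesSide H e ⊆ H := filter_subset _ _

theorem noSide_subset (H : Finset (Fin m)) (e : Fin n) : A.noSide H e ⊆ H := filter_subset _ _

theorem uncovered_subset (E : Finset (Fin n)) (H : Finset (Fin m)) : A.uncovered E H ⊆ H :=
  filter_subset _ _

theorem mem_uncovered {E : Finset (Fin n)} {H : Finset (Fin m)} {i : Fin m} :
    i ∈ A.uncovered E H ↔ i ∈ H ∧ A.f i E < 1 := mem_filter

theorem sum_sides (H : Finset (Fin m)) (e : Fin n) (g : Fin m → ℝ) :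
    ∑ i ∈ A.yesSide H e, g i + ∑ i ∈ A.noSide H e, g i = ∑ i ∈ H, g i :=
  sum_filter_add_sum_filter_not H _ g

theorem card_sides (H : Finset (Fin m)) (e : Fin n) :
    #(A.yesSide H e) + #(A.noSide H e) = #H := card_filter_add_card_filter_not _

theorem IsLight.subset {H L : Finset (Fin m)} {e : Fin n} (h : A.IsLight H e L) : L ⊆ H := by
  rcases h.1 with rfl | rfl
  exacts [yesSide_subset H e, noSide_subset H e]

theorem IsLight.two_mul_card_le {H L : Finset (Fin m)} {e : Fin n} (h : A.IsLight H e L) :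
    2 * #L ≤ #H := by
  have := card_sides (A := A) H e
  have := h.2.1
  have := h.2.2
  omega

theorem score_eq_sum_gain {E : Finset (Fin n)} {H L : Finset (Fin m)} {e : Fin n} (h : L ⊆ H) :
    A.score E H L e = (∑ i ∈ H, A.p i * A.gain E L e i) / A.c e := by
  have : ∑ j ∈ L, A.p j = ∑ i ∈ H, A.p i * (if i ∈ L then 1 else 0) := by
    simp only [mul_ite, mul_one, mul_zero, ← sum_filter]
    rw [filter_mem_eq_inter, inter_eq_right.2 h]
  simp only [score, gain, mul_add, sum_add_distrib, this]
  ring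

theorem IsInstance.gain_nonneg (hA : A.IsInstance) (E : Finset (Fin n)) (L : Finset (Fin m))
    (e : Fin n) (i : Fin m) : 0 ≤ A.gain E L e i := by
  have h1 := hA.f_mono i E (insert e E) (subset_insert e E)
  have h2 := (hA.f_mem i E).2
  unfold gain
  have : 0 ≤ (A.f i (insert e E) - A.f i E) / (1 - A.f i E) :=
    div_nonneg (by linarith) (by linarith)
  split_ifs <;> linarith

end ASRData

/-! ### The potential, and scores against a competing policy -/

namespace ECD

open ASRData

variable {m n : ℕ} (I : ECD m n)

theorem costUntil_of_recognized {i : Fin m} {E : Finset (Fin n)} (h : I.Recognized i E)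
    (l : List (Fin n)) : I.costUntil i E l = 0 := by
  cases l with
  | nil => rfl
  | cons e l => simp [costUntil, h]

theorem costUntil_of_not_recognized {i : Fin m} {E : Finset (Fin n)} (h : ¬I.Recognized i E)
    (e : Fin n) (l : List (Fin n)) :
    I.costUntil i E (e :: l) = I.c e + I.costUntil i (insert e E) l := by
  simp [costUntil, h]

theorem costUntil_nonneg (i : Fin m) (E : Finset (Fin n)) (l : List (Fin n)) :
    0 ≤ I.costUntil i E l := by
  induction l generalizing E with
  | nil => exact le_rfl
  | cons e l ih =>
    unfold costUntil
    split_ifs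
    exacts [le_rfl, add_nonneg (I.c_pos e).le (ih _)]

/-- The bound on the total gain that an uncovered hypothesis `i` of `H` can still receive. -/
noncomputable def potential (E : Finset (Fin n)) (H : Finset (Fin m)) (i : Fin m) : ℝ :=
  Real.logb 2 #H + 1 + Real.log (#(I.Q.part i)ᶜ * (1 - I.toASR.f i E))

variable {I}

theorem logb_card_nonneg {H : Finset (Fin m)} (h : H.Nonempty) : 0 ≤ Real.logb 2 (#H : ℝ) :=
  Real.logb_nonneg (by norm_num) (by exact_mod_cast h.card_pos)

/-- Landing on the light side at least halves the set of candidates, so a unit of gain is paid by a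
drop of 1 in the binary logarithm. -/
theorem indicator_light_le {H L H' : Finset (Fin m)} {i : Fin m} (h2 : 2 * #L ≤ #H)
    (hH' : H' ⊆ H) (hne : H'.Nonempty) (hL : i ∈ L → H' ⊆ L) :
    (if i ∈ L then (1 : ℝ) else 0) + Real.logb 2 #H' ≤ Real.logb 2 #H := by
  have hpos : (0 : ℝ) < #H' := by exact_mod_cast hne.card_pos
  split_ifs with hi
  · have h : 2 * #H' ≤ #H := le_trans (Nat.mul_le_mul_left 2 (card_le_card (hL hi))) h2
    have h' : (2 : ℝ) * #H' ≤ #H := by exact_mod_cast h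
    calc 1 + Real.logb 2 (#H' : ℝ) = Real.logb 2 (2 * #H') := by
          rw [Real.logb_mul (by norm_num) hpos.ne', Real.logb_self_eq_one (by norm_num)]
      _ ≤ _ := Real.logb_le_logb_of_le (by norm_num) (by positivity) h'
  · rw [zero_add]
    exact Real.logb_le_logb_of_le (by norm_num) hpos (by exact_mod_cast card_le_card hH')

/-- The telescoping step while `i` stays uncovered: the two logarithms of the potential pay
separately for the two summands of the gain. -/
theorem gain_add_potential_le (hQ : 2 ≤ #I.Q.parts) {E : Finset (Fin n)} {H L H' : Finset (Fin m)}
    {e : Fin n} {i : Fin m} (hlight : I.toASR.IsLight H e L) (hf : I.toASR.f i E < 1)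
    (hf' : I.toASR.f i (insert e E) < 1) (hH' : H' ⊆ H) (hi : i ∈ H') (hL : i ∈ L → H' ⊆ L) :
    I.toASR.gain E L e i + I.potential (insert e E) H' i ≤ I.potential E H i := by
  have h1 := indicator_light_le hlight.two_mul_card_le hH' ⟨i, hi⟩ hL
  have hN : (0 : ℝ) < #(I.Q.part i)ᶜ := by exact_mod_cast card_compl_part_pos hQ i
  have ha : 0 < 1 - I.toASR.f i E := by linarith
  have hb : 0 < 1 - I.toASR.f i (insert e E) := by linarith
  -- With `x` the ratio of the new residual to the old one, relative progress is `1 - x ≤ -log x`.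
  have h2 := Real.log_le_sub_one_of_pos (div_pos hb ha)
  rw [Real.log_div hb.ne' ha.ne'] at h2
  have h3 : (I.toASR.f i (insert e E) - I.toASR.f i E) / (1 - I.toASR.f i E)
      = 1 - (1 - I.toASR.f i (insert e E)) / (1 - I.toASR.f i E) := by
    field_simp
    ring
  unfold potential gain
  rw [Real.log_mul hN.ne' ha.ne', Real.log_mul hN.ne' hb.ne', h3]
  linarith

/-- This bounds the final gain even if `i` becomes covered, when the logarithm of the new residual
is unusable. The summand 1 of the potential pays for the progress. -/
theorem gain_le_potential (hQ : 2 ≤ #I.Q.parts) {E : Finset (Fin n)} {H L : Finset (Fin m)}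
    {e : Fin n} {i : Fin m} (hlight : I.toASR.IsLight H e L) (hf : I.toASR.f i E < 1)
    (hi : i ∈ H) : I.toASR.gain E L e i ≤ I.potential E H i := by
  have ha : 0 < 1 - I.toASR.f i E := by linarith
  have h1 : (if i ∈ L then (1 : ℝ) else 0) ≤ Real.logb 2 #H := by
    have := indicator_light_le (i := i) (H' := {i}) hlight.two_mul_card_le
      (singleton_subset_iff.2 hi) (singleton_nonempty i) (by simp)
    simpa using this
  have h2 : (I.toASR.f i (insert e E) - I.toASR.f i E) / (1 - I.toASR.f i E) ≤ 1 := by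
    rw [div_le_one ha]
    linarith [((isInstance_toASR hQ).f_mem i (insert e E)).2]
  have h3 := Real.log_nonneg (one_le_card_mul_residual hQ hf)
  unfold potential gain
  linarith

/-- Following a decision tree into the side opposite to `L e` at each test `e`, as long as the
budget `τ` permits, yields a set of tests that handles every hypothesis of cost at most `τ`. -/
theorem exists_tests_of_budget {H : Finset (Fin m)} {L : Fin n → Finset (Fin m)}
    (hL : ∀ e, L e = I.toASR.yesSide H e ∨ L e = I.toASR.noSide H e) (T : DTree (Fin n)) :
    ∀ (X : Finset (Fin n)) (τ : ℝ), 0 ≤ τ → ∃ P : Finset (Fin n), ∑ e ∈ P, I.c e ≤ τ ∧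
      ∀ i ∈ H, I.Recognized i (X ∪ (T.path (I.S i)).toFinset) →
        I.costUntil i X (T.path (I.S i)) ≤ τ → (∃ e ∈ P, i ∈ L e) ∨ I.Recognized i (X ∪ P) := by
  induction T with
  | leaf =>
    intro X τ hτ
    exact ⟨∅, by simpa using hτ, fun i _ hr _ => Or.inr (by simpa [DTree.path] using hr)⟩
  | node e yes no ihy ihn =>
    intro X τ hτ
    -- If `e` exceeds the budget, stop: a hypothesis of cost at most `τ` must already be recognized
    -- by `X`.
    rcases lt_or_ge τ (I.c e) with hc | hc
    · refine ⟨∅, by simpa using hτ, fun i _ hr hcost => Or.inr ?_⟩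
      by_contra hnr
      have hnr' : ¬I.Recognized i X := by simpa using hnr
      rw [DTree.path, costUntil_of_not_recognized I hnr'] at hcost
      linarith [I.costUntil_nonneg i (insert e X)
        (if e ∈ I.S i then yes.path (I.S i) else no.path (I.S i))]
    -- Here `t` is the branch opposite to `L e`. Hypotheses in `L e` are handled by `e` itself, and
    -- all others continue in `t` with budget `τ - c e`.
    · have extend : ∀ t : DTree (Fin n),
          (∀ i ∈ H, i ∉ L e → DTree.path (I.S i) (.node e yes no) = e :: t.path (I.S i)) →
          (∃ P : Finset (Fin n), ∑ e ∈ P, I.c e ≤ τ - I.c e ∧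
            ∀ i ∈ H, I.Recognized i (insert e X ∪ (t.path (I.S i)).toFinset) →
              I.costUntil i (insert e X) (t.path (I.S i)) ≤ τ - I.c e →
              (∃ e ∈ P, i ∈ L e) ∨ I.Recognized i (insert e X ∪ P)) →
          ∃ P : Finset (Fin n), ∑ e ∈ P, I.c e ≤ τ ∧
            ∀ i ∈ H, I.Recognized i (X ∪ (DTree.path (I.S i) (.node e yes no)).toFinset) →
              I.costUntil i X (DTree.path (I.S i) (.node e yes no)) ≤ τ →
              (∃ e ∈ P, i ∈ L e) ∨ I.Recognized i (X ∪ P) := by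
        rintro t hpath ⟨P, hP, hrec⟩
        refine ⟨insert e P, ?_, fun i hi hr hcost => ?_⟩
        -- A test repeated further down is counted only once in `P`.
        · by_cases heP : e ∈ P
          · rw [insert_eq_of_mem heP]
            linarith [I.c_pos e]
          · rw [sum_insert heP]
            linarith
        · by_cases hie : i ∈ L e
          · exact Or.inl ⟨e, mem_insert_self e P, hie⟩
          by_cases hX : I.Recognized i X
          · exact Or.inr (I.recognized_mono subset_union_left hX)
          rw [hpath i hi hie] at hr hcost
          rw [costUntil_of_not_recognized I hX] at hcost
          rw [List.toFinset_cons, union_insert, ← insert_union] at hr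
          rcases hrec i hi hr (by linarith) with ⟨e', he', h⟩ | h
          · exact Or.inl ⟨e', mem_insert_of_mem he', h⟩
          · rw [insert_union, ← union_insert] at h
            exact Or.inr h
      rcases hL e with h | h
      · refine extend no (fun i hi hie => ?_) (ihn _ _ (by linarith))
        have : e ∉ I.S i := fun he => hie (h ▸ mem_filter.2 ⟨hi, he⟩)
        simp [DTree.path, this]
      · refine extend yes (fun i hi hie => ?_) (ihy _ _ (by linarith))
        have : e ∈ I.S i := by
          by_contra he
          exact hie (h ▸ mem_filter.2 ⟨hi, he⟩)
        simp [DTree.path, this]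

/-- The hypotheses of `H` that a feasible policy recognizes at cost at most `τ` have total
probability at most `τ` times the maximum score. -/
theorem mass_le_score_mul_budget (hQ : 2 ≤ #I.Q.parts) {T : DTree (Fin n)} (hT : I.Feasible T)
    {E : Finset (Fin n)} {H : Finset (Fin m)} {L : Fin n → Finset (Fin m)} {s : ℝ}
    (hf : ∀ i ∈ H, I.toASR.f i E < 1)
    (hcomp : ∀ i ∈ H, ∀ j ∈ H, ∀ e ∈ E, (e ∈ I.S i ↔ e ∈ I.S j))
    (hL : ∀ e ∉ E, I.toASR.IsLight H e (L e)) (hs0 : 0 ≤ s)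
    (hs : ∀ e ∉ E, I.toASR.score E H (L e) e ≤ s) {τ : ℝ} (hτ : 0 ≤ τ) :
    ∑ i ∈ H with I.costUntil i ∅ (T.path (I.S i)) ≤ τ, I.p i ≤ s * τ := by
  have hA := isInstance_toASR hQ
  have hempty : ∀ e ∈ E, I.toASR.yesSide H e = ∅ ∨ I.toASR.noSide H e = ∅ := by
    intro e he
    by_contra! hcon
    obtain ⟨⟨i, hi⟩, ⟨j, hj⟩⟩ := hcon
    obtain ⟨hi, hie⟩ := mem_filter.1 hi
    obtain ⟨hj, hje⟩ := mem_filter.1 hj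
    exact hje ((hcomp i hi j hj e he).1 hie)
  -- All of `H` agrees on a test already in `E`, so one of its sides is empty. Taking that side as
  -- light, no hypothesis leaves the path there.
  let L' : Fin n → Finset (Fin m) := fun e => if e ∈ E then ∅ else L e
  have hL' : ∀ e, L' e = I.toASR.yesSide H e ∨ L' e = I.toASR.noSide H e := by
    intro e
    by_cases he : e ∈ E
    · simp only [L', he, if_true]
      exact (hempty e he).imp Eq.symm Eq.symm
    · simp only [L', he, if_false]
      exact (hL e he).1
  obtain ⟨P, hP, hrec⟩ := exists_tests_of_budget hL' T ∅ τ hτ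
  have hgain : ∀ i ∈ H, I.costUntil i ∅ (T.path (I.S i)) ≤ τ →
      1 ≤ ∑ e ∈ P \ E, I.toASR.gain E (L e) e i := by
    intro i hi hcost
    have hpos : 0 < 1 - I.toASR.f i E := by linarith [hf i hi]
    -- Leaving on a light side gives gain 1 from the indicator alone. Otherwise `P` removes the
    -- whole residual, and submodularity distributes it over the tests of `P \ E`.
    rcases hrec i hi (by simpa using hT i) hcost with ⟨e, heP, hie⟩ | h
    · have heE : e ∉ E := fun he => by simp [L', he] at hie
      simp only [L', heE, if_false] at hie
      have h1 := single_le_sum (fun e _ => hA.gain_nonneg E (L e) e i) (mem_sdiff.2 ⟨heP, heE⟩)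
      refine le_trans ?_ h1
      -- With the empty light side, the gain is just the relative progress, so this is its
      -- nonnegativity.
      have := hA.gain_nonneg E ∅ e i
      simp only [gain, notMem_empty, if_false] at this
      simp only [gain, hie, if_true]
      linarith
    · rw [empty_union] at h
      have h1 : I.toASR.f i (E ∪ P) = 1 :=
        (toASR_f_eq_one_iff hQ i _).2 (I.recognized_mono subset_union_right h)
      have h2 := hA.residual_le_sum i E P
      rw [h1] at h2
      calc (1 : ℝ) = (1 - I.toASR.f i E) / (1 - I.toASR.f i E) := (div_self hpos.ne').symm
        _ ≤ (∑ e ∈ P \ E, (I.toASR.f i (insert e E) - I.toASR.f i E)) / (1 - I.toASR.f i E) := by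
          gcongr
        _ ≤ _ := by
          rw [sum_div]
          refine sum_le_sum fun e _ => ?_
          unfold gain
          split_ifs <;> linarith
  calc ∑ i ∈ H with I.costUntil i ∅ (T.path (I.S i)) ≤ τ, I.p i
      ≤ ∑ i ∈ H, I.p i * ∑ e ∈ P \ E, I.toASR.gain E (L e) e i := by
        rw [sum_filter]
        refine sum_le_sum fun i hi => ?_
        split_ifs with hc
        · exact le_mul_of_one_le_right (I.p_nonneg i) (hgain i hi hc)
        · exact mul_nonneg (I.p_nonneg i) (sum_nonneg fun e _ => hA.gain_nonneg _ _ _ _)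
    _ = ∑ e ∈ P \ E, ∑ i ∈ H, I.p i * I.toASR.gain E (L e) e i := by
        simp only [mul_sum]
        exact sum_comm
    _ ≤ ∑ e ∈ P \ E, s * I.c e := by
        refine sum_le_sum fun e he => ?_
        have heE := (mem_sdiff.1 he).2
        have h := hs e heE
        rw [score_eq_sum_gain (hL e heE).subset] at h
        exact (div_le_iff₀ (I.c_pos e)).1 h
    _ ≤ ∑ e ∈ P, s * I.c e :=
        sum_le_sum_of_subset_of_nonneg sdiff_subset
          fun e _ _ => mul_nonneg hs0 (I.c_pos e).le
    _ ≤ s * τ := by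
        rw [← mul_sum]
        exact mul_le_mul_of_nonneg_left hP hs0

end ECD

/-! ### Comparing means by integrating tails -/

/-- If the tails of `M` are dominated by those of `O`, up to a factor `2` and a scaling by `2`,
then so is the mean. -/
theorem sum_mul_le_of_tail_le {ι : Type*} (s : Finset ι) (p M O : ι → ℝ) (hM : ∀ i, 0 ≤ M i)
    (hO : ∀ i, 0 ≤ O i)
    (h : ∀ t, 0 < t → ∑ i ∈ s with t ≤ M i, p i ≤ 2 * ∑ i ∈ s with t < 2 * O i, p i) :
    ∑ i ∈ s, p i * M i ≤ 4 * ∑ i ∈ s, p i * O i := by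
  classical
  have int1 : ∀ i, MeasureTheory.Integrable
      (fun t => p i * (Set.Ioc 0 (M i)).indicator (1 : ℝ → ℝ) t) := fun i =>
    ((MeasureTheory.integrable_indicator_iff measurableSet_Ioc).2
      (MeasureTheory.integrableOn_const measure_Ioc_lt_top.ne)).const_mul _
  have int2 : ∀ i, MeasureTheory.Integrable
      (fun t => p i * (Set.Ioo 0 (2 * O i)).indicator (1 : ℝ → ℝ) t) := fun i =>
    ((MeasureTheory.integrable_indicator_iff measurableSet_Ioo).2
      (MeasureTheory.integrableOn_const measure_Ioo_lt_top.ne)).const_mul _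
  -- Layer-cake formula: `M i` is the length of `(0, M i]`. For the other side, the interval `(0, 2
  -- * O i)` and the factor 2 together make the 4.
  have e1 : ∑ i ∈ s, p i * M i
      = ∫ t, ∑ i ∈ s, p i * (Set.Ioc 0 (M i)).indicator (1 : ℝ → ℝ) t := by
    rw [MeasureTheory.integral_finsetSum _ fun i _ => int1 i]
    refine sum_congr rfl fun i _ => ?_
    rw [MeasureTheory.integral_const_mul, MeasureTheory.integral_indicator_one measurableSet_Ioc,
      Real.volume_real_Ioc_of_le (hM i), sub_zero]
  have e2 : 4 * ∑ i ∈ s, p i * O i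
      = ∫ t, 2 * ∑ i ∈ s, p i * (Set.Ioo 0 (2 * O i)).indicator (1 : ℝ → ℝ) t := by
    rw [MeasureTheory.integral_const_mul, MeasureTheory.integral_finsetSum _ fun i _ => int2 i,
      mul_sum, mul_sum]
    refine sum_congr rfl fun i _ => ?_
    rw [MeasureTheory.integral_const_mul, MeasureTheory.integral_indicator_one measurableSet_Ioo,
      Real.volume_real_Ioo_of_le (by linarith [hO i])]
    ring
  rw [e1, e2]
  refine MeasureTheory.integral_mono (MeasureTheory.integrable_finsetSum _ fun i _ => int1 i)
    ((MeasureTheory.integrable_finsetSum _ fun i _ => int2 i).const_mul 2) fun t => ?_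
  rcases le_or_gt t 0 with ht | ht
  · simp [Set.indicator, not_lt.2 ht]
  · simpa [Set.indicator, ht, sum_filter] using h t ht

/-! ### Feasibility and the charging argument for the greedy tree -/

namespace ECD

open ASRData

variable {m n : ℕ} {I : ECD m n}

/-- "In `H` or already recognized" is preserved along the path of `i`. At a leaf `H` is empty, so
only recognition remains. -/
theorem GreedyFrom.recognized (hQ : 2 ≤ #I.Q.parts) {E : Finset (Fin n)} {H : Finset (Fin m)}
    {T : DTree (Fin n)} (h : I.toASR.GreedyFrom E H T) :
    ∀ i, i ∈ H ∨ I.Recognized i E → I.Recognized i (E ∪ (T.path (I.S i)).toFinset) := by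
  induction h with
  | finished E => exact fun i hi => by simpa [DTree.path] using hi
  | display E H e yes no _ _ _ _ ihy ihn =>
    intro i hi
    have next : ∀ (Z : Finset (Fin m)), (i ∈ H → i ∈ Z) →
        i ∈ I.toASR.uncovered (insert e E) Z ∨ I.Recognized i (insert e E) := by
      intro Z hZ
      rcases hi with hi | hi
      · rcases lt_or_eq_of_le ((isInstance_toASR hQ).f_mem i (insert e E)).2 with h | h
        · exact Or.inl (mem_uncovered.2 ⟨hZ hi, h⟩)
        · exact Or.inr ((toASR_f_eq_one_iff hQ i _).1 h)
      · exact Or.inr (I.recognized_mono (subset_insert e E) hi)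
    by_cases he : e ∈ I.S i
    · have := ihy i (next _ fun hi => mem_filter.2 ⟨hi, he⟩)
      simpa [DTree.path, he] using this
    · have := ihn i (next _ fun hi => mem_filter.2 ⟨hi, he⟩)
      simpa [DTree.path, he] using this

/-- One side of a step of the greedy algorithm: the cost of continuing with `t` after `e`, together
with the gain of `e` at price `π`, is paid by the potential. -/
theorem side_cost_le (hQ : 2 ≤ #I.Q.parts) {E : Finset (Fin n)} {H L Z : Finset (Fin m)}
    {e : Fin n} {t : DTree (Fin n)} {M : Fin m → ℝ} {π : ℝ} (hπ : 0 ≤ π)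
    (hf : ∀ i ∈ H, I.toASR.f i E < 1) (hlight : I.toASR.IsLight H e L) (hZ : Z ⊆ H)
    (hZL : ∀ i ∈ Z, i ∈ L → Z ⊆ L)
    (hcost : ∑ i ∈ I.toASR.uncovered (insert e E) Z,
        I.p i * I.costUntil i (insert e E) (t.path (I.S i)) ≤
      ∑ i ∈ I.toASR.uncovered (insert e E) Z,
        I.p i * (I.potential (insert e E) (I.toASR.uncovered (insert e E) Z) i * M i)) :
    ∑ i ∈ Z, (I.p i * I.costUntil i (insert e E) (t.path (I.S i)) +
        π * (I.p i * I.toASR.gain E L e i)) ≤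
      ∑ i ∈ Z, I.p i * (I.potential E H i * max π (M i)) := by
  have hA := isInstance_toASR hQ
  -- Hypotheses that `e` has just made recognized incur no further cost.
  have hsplit : ∑ i ∈ Z, I.p i * I.costUntil i (insert e E) (t.path (I.S i)) =
      ∑ i ∈ I.toASR.uncovered (insert e E) Z,
        I.p i * I.costUntil i (insert e E) (t.path (I.S i)) := by
    refine (sum_subset (uncovered_subset _ _) fun i hi hn => ?_).symm
    have h1 : I.toASR.f i (insert e E) = 1 :=
      le_antisymm (hA.f_mem i _).2 (not_lt.1 fun hlt => hn (mem_uncovered.2 ⟨hi, hlt⟩))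
    rw [I.costUntil_of_recognized ((toASR_f_eq_one_iff hQ i _).1 h1), mul_zero]
  have hext : ∑ i ∈ I.toASR.uncovered (insert e E) Z,
        I.p i * (I.potential (insert e E) (I.toASR.uncovered (insert e E) Z) i * M i) =
      ∑ i ∈ Z, if I.toASR.f i (insert e E) < 1 then
        I.p i * (I.potential (insert e E) (I.toASR.uncovered (insert e E) Z) i * M i) else 0 := by
    rw [← sum_filter]
    exact sum_congr (by ext; simp [mem_uncovered]) fun _ _ => rfl
  rw [sum_add_distrib, hsplit]
  refine (add_le_add_left (hcost.trans_eq hext) _).trans ?_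
  rw [← sum_add_distrib]
  refine sum_le_sum fun i hi => ?_
  have hg := hA.gain_nonneg E L e i
  have hmax : 0 ≤ max π (M i) := hπ.trans (le_max_left _ _)
  have h1 : π * I.toASR.gain E L e i ≤ I.toASR.gain E L e i * max π (M i) := by
    rw [mul_comm]
    exact mul_le_mul_of_nonneg_left (le_max_left _ _) hg
  have h0 : π * (I.p i * I.toASR.gain E L e i) = I.p i * (π * I.toASR.gain E L e i) := by ring
  rw [h0]
  split_ifs with hf'
  · have hiU : i ∈ I.toASR.uncovered (insert e E) Z := mem_uncovered.2 ⟨hi, hf'⟩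
    have hpot := gain_add_potential_le hQ hlight (hf i (hZ hi)) hf'
      ((uncovered_subset _ _).trans hZ) hiU fun hiL => (uncovered_subset _ _).trans (hZL i hi hiL)
    have hpot' : 0 ≤ I.potential (insert e E) (I.toASR.uncovered (insert e E) Z) i := by
      have := Real.log_nonneg (one_le_card_mul_residual hQ hf')
      have := logb_card_nonneg ⟨i, hiU⟩
      unfold potential
      linarith
    rw [← mul_add]
    refine mul_le_mul_of_nonneg_left ?_ (I.p_nonneg i)
    have h2 := mul_le_mul_of_nonneg_left (le_max_right π (M i)) hpot'
    have h3 := mul_le_mul_of_nonneg_right hpot hmax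
    linarith
  · rw [zero_add]
    refine mul_le_mul_of_nonneg_left (h1.trans ?_) (I.p_nonneg i)
    exact mul_le_mul_of_nonneg_right (gain_le_potential hQ hlight (hf i (hZ hi)) (hZ hi)) hmax

/-- The cost of the greedy algorithm is bounded by means of prices `M i` whose tails are dominated
by the costs of any feasible policy `T'`. -/
theorem GreedyFrom.exists_price (hQ : 2 ≤ #I.Q.parts) {T' : DTree (Fin n)} (hT' : I.Feasible T')
    {E : Finset (Fin n)} {H : Finset (Fin m)} {T : DTree (Fin n)}
    (h : I.toASR.GreedyFrom E H T) :
    (∀ i ∈ H, I.toASR.f i E < 1) →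
    (∀ i ∈ H, ∀ j ∈ H, ∀ e ∈ E, (e ∈ I.S i ↔ e ∈ I.S j)) →
    ∃ M : Fin m → ℝ, (∀ i, 0 ≤ M i) ∧ (∀ i ∉ H, M i = 0) ∧
      (∑ i ∈ H, I.p i * I.costUntil i E (T.path (I.S i)) ≤
        ∑ i ∈ H, I.p i * (I.potential E H i * M i)) ∧
      ∀ t, 0 < t → ∑ i ∈ H with t ≤ M i, I.p i ≤
        2 * ∑ i ∈ H with t < 2 * I.costUntil i ∅ (T'.path (I.S i)), I.p i := by
  induction h with
  | finished E =>
    exact fun _ _ => ⟨fun _ => 0, fun _ => le_rfl, fun _ _ => rfl, by simp, by simp⟩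
  | display E H e yes no _ hchoice _ _ ihy ihn =>
    intro hf hcomp
    obtain ⟨L, hL, heE, hmax⟩ := hchoice
    have hA := isInstance_toASR hQ
    have hlight := hL e heE
    set O : Fin m → ℝ := fun i => I.costUntil i ∅ (T'.path (I.S i))
    have hO0 : ∀ i, 0 ≤ O i := fun i => I.costUntil_nonneg _ _ _
    set s := I.toASR.score E H (L e) e with hs
    have hseq : s = (∑ i ∈ H, I.p i * I.toASR.gain E (L e) e i) / I.c e :=
      score_eq_sum_gain hlight.subset
    have hs0 : 0 ≤ s := by
      rw [hseq]
      exact div_nonneg (sum_nonneg fun i _ => mul_nonneg (I.p_nonneg i) (hA.gain_nonneg _ _ _ _))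
        (I.c_pos e).le
    have hmass : ∀ τ, 0 ≤ τ → ∑ i ∈ H with O i ≤ τ, I.p i ≤ s * τ := fun τ hτ =>
      mass_le_score_mul_budget hQ hT' hf hcomp hL hs0 hmax hτ
    -- The price of this state, chosen so that price times weighted gain equals the expected payment
    -- for `e`.
    set π := (∑ i ∈ H, I.p i) / s with hπ
    have hp0 : 0 ≤ ∑ i ∈ H, I.p i := sum_nonneg fun i _ => I.p_nonneg i
    have hπ0 : 0 ≤ π := div_nonneg hp0 hs0
    have hpay : ∑ i ∈ H, I.p i * I.c e = π * ∑ i ∈ H, I.p i * I.toASR.gain E (L e) e i := by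
      have hg : ∑ i ∈ H, I.p i * I.toASR.gain E (L e) e i = s * I.c e := by
        rw [hseq, div_mul_cancel₀ _ (I.c_pos e).ne']
      rw [hg, ← sum_mul, ← mul_assoc]
      congr 1
      rcases hs0.eq_or_lt with h0 | hpos
      -- If `s = 0`, a budget exceeding every cost of `T'` shows that `H` has mass zero, and both
      -- sides vanish.
      · have hall := hmass (∑ i, O i) (sum_nonneg fun i _ => hO0 i)
        rw [filter_true_of_mem fun i _ => single_le_sum (fun j _ => hO0 j) (mem_univ i), ← h0,
          zero_mul] at hall
        rw [← h0, mul_zero]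
        exact le_antisymm hall hp0
      · rw [hπ, div_mul_cancel₀ _ hpos.ne']
    have hcompat : ∀ Z : Finset (Fin m), Z ⊆ H →
        (∀ i ∈ Z, ∀ j ∈ Z, (e ∈ I.S i ↔ e ∈ I.S j)) →
        ∀ i ∈ I.toASR.uncovered (insert e E) Z, ∀ j ∈ I.toASR.uncovered (insert e E) Z,
          ∀ e' ∈ insert e E, (e' ∈ I.S i ↔ e' ∈ I.S j) := by
      intro Z hZ he i hi j hj e' he'
      have hiZ := uncovered_subset _ _ hi
      have hjZ := uncovered_subset _ _ hj
      rcases mem_insert.1 he' with heq | he'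
      · exact heq ▸ he i hiZ j hjZ
      · exact hcomp i (hZ hiZ) j (hZ hjZ) e' he'
    have hY : ∀ i ∈ I.toASR.yesSide H e, e ∈ I.S i := fun i hi => (mem_filter.1 hi).2
    have hN : ∀ i ∈ I.toASR.noSide H e, e ∉ I.S i := fun i hi => (mem_filter.1 hi).2
    obtain ⟨My, hMy0, hMyout, hcosty, htaily⟩ := ihy (fun i hi => (mem_uncovered.1 hi).2)
      (hcompat _ (yesSide_subset H e) fun i hi j hj => iff_of_true (hY i hi) (hY j hj))
    obtain ⟨Mn, hMn0, hMnout, hcostn, htailn⟩ := ihn (fun i hi => (mem_uncovered.1 hi).2)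
      (hcompat _ (noSide_subset H e) fun i hi j hj => iff_of_false (hN i hi) (hN j hj))
    -- The price of `i` is the maximum of `π` and its price in the subtree that it enters. The
    -- latter is 0 if `e` completes recognition.
    refine ⟨fun i => if i ∈ H then max π (if e ∈ I.S i then My i else Mn i) else 0,
      fun i => ?_, fun i hi => if_neg hi, ?_, fun t ht => ?_⟩
    · dsimp only
      split_ifs
      exacts [hπ0.trans (le_max_left _ _), hπ0.trans (le_max_left _ _), le_rfl]
    · have hy := side_cost_le hQ hπ0 hf hlight (yesSide_subset H e) (fun i hi hiL => by
        rcases hlight.1 with h | h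
        · rw [h]
        · rw [h] at hiL
          exact absurd (hY i hi) (hN i hiL)) hcosty
      have hn := side_cost_le hQ hπ0 hf hlight (noSide_subset H e) (fun i hi hiL => by
        rcases hlight.1 with h | h
        · rw [h] at hiL
          exact absurd (hY i hiL) (hN i hi)
        · rw [h]) hcostn
      calc ∑ i ∈ H, I.p i * I.costUntil i E (DTree.path (I.S i) (.node e yes no))
          = ∑ i ∈ H, (I.p i * I.costUntil i (insert e E)
              (if e ∈ I.S i then yes.path (I.S i) else no.path (I.S i)) +
              π * (I.p i * I.toASR.gain E (L e) e i)) := by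
            rw [sum_add_distrib, ← mul_sum, ← hpay, ← sum_add_distrib]
            refine sum_congr rfl fun i hi => ?_
            rw [DTree.path, I.costUntil_of_not_recognized (not_recognized_of_lt hQ (hf i hi))]
            ring
        _ = ∑ i ∈ I.toASR.yesSide H e,
              (I.p i * I.costUntil i (insert e E) (yes.path (I.S i)) +
                π * (I.p i * I.toASR.gain E (L e) e i)) +
            ∑ i ∈ I.toASR.noSide H e,
              (I.p i * I.costUntil i (insert e E) (no.path (I.S i)) +
                π * (I.p i * I.toASR.gain E (L e) e i)) := by
            rw [← sum_sides (A := I.toASR) H e]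
            congr 1
            · exact sum_congr rfl fun i hi => by rw [if_pos (hY i hi)]
            · exact sum_congr rfl fun i hi => by rw [if_neg (hN i hi)]
        _ ≤ ∑ i ∈ I.toASR.yesSide H e, I.p i * (I.potential E H i * max π (My i)) +
            ∑ i ∈ I.toASR.noSide H e, I.p i * (I.potential E H i * max π (Mn i)) :=
            add_le_add hy hn
        _ = _ := by
            rw [← sum_sides (A := I.toASR) H e]
            congr 1
            · refine sum_congr rfl fun i hi => ?_
              dsimp only
              rw [if_pos (yesSide_subset H e hi), if_pos (hY i hi)]
            · refine sum_congr rfl fun i hi => ?_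
              dsimp only
              rw [if_pos (noSide_subset H e hi), if_neg (hN i hi)]
    · rcases le_or_gt t π with htπ | htπ
      -- For `t ≤ π` all of `H` has price at least `t`. Budget `t / 2` captures at most half of its
      -- mass, so the rest, where `t < 2 * O i`, has at least half.
      · have hspos : 0 < s := by
          rcases hs0.eq_or_lt with h0 | hpos
          · rw [hπ, ← h0, div_zero] at htπ
            linarith
          · exact hpos
        have hsmall := hmass (t / 2) (by linarith)
        have hst : s * t ≤ ∑ i ∈ H, I.p i := by
          rw [hπ, le_div_iff₀ hspos] at htπ
          linarith
        have hsum := sum_filter_add_sum_filter_not H (fun i => O i ≤ t / 2) I.p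
        have hbig : ∑ i ∈ H with ¬O i ≤ t / 2, I.p i = ∑ i ∈ H with t < 2 * O i, I.p i :=
          sum_congr (filter_congr fun i _ => by
            rw [not_le]
            constructor <;> intro h <;> linarith) fun _ _ => rfl
        have hle : ∑ i ∈ H with t ≤ (if i ∈ H then max π (if e ∈ I.S i then My i else Mn i)
            else 0), I.p i ≤ ∑ i ∈ H, I.p i :=
          sum_le_sum_of_subset_of_nonneg (filter_subset _ _) fun i _ _ => I.p_nonneg i
        linarith
      -- For `π < t` the current price is irrelevant and the tail bounds of the two subtrees add up.
      -- Hypotheses just recognized have subtree price 0, hence do not occur.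
      · have side : ∀ (Z : Finset (Fin m)) (M' : Fin m → ℝ), Z ⊆ H →
            (∀ i ∉ I.toASR.uncovered (insert e E) Z, M' i = 0) →
            (∀ i ∈ Z, (if e ∈ I.S i then My i else Mn i) = M' i) →
            (∑ i ∈ I.toASR.uncovered (insert e E) Z with t ≤ M' i, I.p i ≤
              2 * ∑ i ∈ I.toASR.uncovered (insert e E) Z with t < 2 * O i, I.p i) →
            ∑ i ∈ Z, (if t ≤ (if i ∈ H then max π (if e ∈ I.S i then My i else Mn i) else 0)
              then I.p i else 0) ≤ 2 * ∑ i ∈ Z, if t < 2 * O i then I.p i else 0 := by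
          intro Z M' hZ hout heq htail
          rw [← sum_filter, ← sum_filter]
          have h1 : ({i ∈ Z | t ≤ if i ∈ H then max π (if e ∈ I.S i then My i else Mn i) else 0} :
              Finset (Fin m)) = {i ∈ I.toASR.uncovered (insert e E) Z | t ≤ M' i} := by
            ext i
            simp only [mem_filter]
            constructor
            · rintro ⟨hi, h⟩
              rw [if_pos (hZ hi), heq i hi, le_max_iff] at h
              have h := h.resolve_left (not_le.2 htπ)
              refine ⟨?_, h⟩
              by_contra hnot
              rw [hout i hnot] at h
              linarith
            · rintro ⟨hi, h⟩
              have hiZ := uncovered_subset _ _ hi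
              rw [if_pos (hZ hiZ), heq i hiZ]
              exact ⟨hiZ, h.trans (le_max_right _ _)⟩
          rw [h1]
          refine htail.trans (mul_le_mul_of_nonneg_left ?_ (by norm_num))
          exact sum_le_sum_of_subset_of_nonneg (filter_subset_filter _ (uncovered_subset _ _))
            fun i _ _ => I.p_nonneg i
        have hy := side _ My (yesSide_subset H e) hMyout (fun i hi => if_pos (hY i hi))
          (htaily t ht)
        have hn := side _ Mn (noSide_subset H e) hMnout (fun i hi => if_neg (hN i hi))
          (htailn t ht)
        rw [sum_filter, sum_filter, ← sum_sides (A := I.toASR) H e,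
          ← sum_sides (A := I.toASR) H e (fun i => if t < 2 * O i then I.p i else 0)]
        linarith

theorem uncovered_empty_univ (hQ : 2 ≤ #I.Q.parts) : I.toASR.uncovered ∅ univ = univ :=
  eq_univ_of_forall fun i => mem_uncovered.2
    ⟨mem_univ i, by rw [(isInstance_toASR hQ).f_empty]; exact one_pos⟩

theorem feasible_of_isGreedyTree (hQ : 2 ≤ #I.Q.parts) {T : DTree (Fin n)}
    (h : I.toASR.IsGreedyTree T) : I.Feasible T := fun i => by
  have := GreedyFrom.recognized hQ h i (Or.inl (by rw [uncovered_empty_univ hQ]; exact mem_univ i))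
  rwa [empty_union] at this

theorem expectedCost_greedy_le (hQ : 2 ≤ #I.Q.parts) {T T' : DTree (Fin n)}
    (h : I.toASR.IsGreedyTree T) (hT' : I.Feasible T') :
    I.expectedCost T ≤ 4 * (Real.logb 2 m + 1 + Real.log m) * I.expectedCost T' := by
  unfold ASRData.IsGreedyTree at h
  rw [uncovered_empty_univ hQ] at h
  obtain ⟨M, hM0, -, hcost, htail⟩ := GreedyFrom.exists_price hQ hT' h
    (fun i _ => by rw [(isInstance_toASR hQ).f_empty]; exact one_pos) (by simp)
  have hmean := sum_mul_le_of_tail_le univ I.p M _ hM0 (fun i => I.costUntil_nonneg i ∅ _) htail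
  have hpot : ∀ i, I.potential ∅ univ i ≤ Real.logb 2 m + 1 + Real.log m := by
    intro i
    have hN : (0 : ℝ) < #(I.Q.part i)ᶜ := by exact_mod_cast card_compl_part_pos hQ i
    have hle : (#(I.Q.part i)ᶜ : ℝ) ≤ m := by
      have := card_le_univ (I.Q.part i)ᶜ
      rw [Fintype.card_fin] at this
      exact_mod_cast this
    unfold potential
    rw [(isInstance_toASR hQ).f_empty, sub_zero, mul_one, card_univ, Fintype.card_fin]
    linarith [Real.log_le_log hN hle]
  have hB : 0 ≤ Real.logb 2 (m : ℝ) + 1 + Real.log m := by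
    have h1 : 0 ≤ Real.log (m : ℝ) := Real.log_natCast_nonneg m
    have h2 : 0 ≤ Real.logb 2 (m : ℝ) := div_nonneg h1 (Real.log_nonneg (by norm_num))
    linarith
  calc I.expectedCost T ≤ ∑ i, I.p i * (I.potential ∅ univ i * M i) := hcost
    _ ≤ ∑ i, (Real.logb 2 m + 1 + Real.log m) * (I.p i * M i) := by
        refine sum_le_sum fun i _ => ?_
        have := mul_le_mul_of_nonneg_right (hpot i) (mul_nonneg (I.p_nonneg i) (hM0 i))
        linarith
    _ ≤ (Real.logb 2 m + 1 + Real.log m) *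
          (4 * ∑ i, I.p i * I.costUntil i ∅ (T'.path (I.S i))) := by
        rw [← mul_sum]
        exact mul_le_mul_of_nonneg_left hmean hB
    _ = _ := by
        unfold expectedCost
        ring

theorem two_le_card (hQ : 2 ≤ #I.Q.parts) : 2 ≤ m := by
  have := I.Q.card_parts_le_card
  rw [card_univ, Fintype.card_fin] at this
  omega

theorem expectedCost_greedy_le_log (hQ : 2 ≤ #I.Q.parts) {T T' : DTree (Fin n)}
    (h : I.toASR.IsGreedyTree T) (hT' : I.Feasible T') :
    I.expectedCost T ≤ 20 * Real.log m * I.expectedCost T' := by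
  refine (expectedCost_greedy_le hQ h hT').trans (mul_le_mul_of_nonneg_right ?_
    (sum_nonneg fun i _ => mul_nonneg (I.p_nonneg i) (I.costUntil_nonneg _ _ _)))
  have hm : Real.log 2 ≤ Real.log m :=
    Real.log_le_log (by norm_num) (by exact_mod_cast two_le_card hQ)
  -- Since `log 2 > 1 / 2` and `m ≥ 2`, both `logb 2 m` and 1 are at most `2 * log m`, so the factor
  -- is `4 * (2 + 2 + 1) = 20`.
  have h2 := Real.log_two_gt_d9
  have hlogb : Real.logb 2 (m : ℝ) ≤ 2 * Real.log m := by
    unfold Real.logb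
    rw [div_le_iff₀ (by linarith)]
    nlinarith
  linarith

end ECD

/-! ### Values and step counts of loops -/

namespace Timed

theorem bind_val {α β : Type} (x : Timed α) (g : α → Timed β) :
    (x >>= g).val = (g x.val).val := rfl

theorem bind_steps {α β : Type} (x : Timed α) (g : α → Timed β) :
    (x >>= g).steps = x.steps + (g x.val).steps := rfl

theorem pure_val {α : Type} (a : α) : (pure a : Timed α).val = a := rfl

theorem pure_steps {α : Type} (a : α) : (pure a : Timed α).steps = 0 := rfl

theorem op_val {α : Type} (a : α) : (op a).val = a := rfl

theorem op_steps {α : Type} (a : α) : (op a).steps = 1 := rfl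

theorem loop_val {ι σ : Type} (body : σ → ι → Timed σ) (l : List ι) (s : σ) :
    (loop body l s).val = l.foldl (fun s x => (body s x).val) s := by
  induction l generalizing s with
  | nil => rfl
  | cons x l ih => exact ih _

theorem loop_steps_le {ι σ : Type} {body : σ → ι → Timed σ} {B : ℕ}
    (h : ∀ s x, (body s x).steps ≤ B) (l : List ι) (s : σ) :
    (loop body l s).steps ≤ l.length * (B + 1) := by
  induction l generalizing s with
  | nil => simp [loop, pure_steps]
  | cons x l ih =>
    have h1 := h s x
    have h2 := ih (body s x).val
    simp only [loop, bind_steps, op_steps, op_val, List.length_cons]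
    linarith

theorem loop_finRange_steps_le {k : ℕ} {σ : Type} {body : σ → Fin k → Timed σ} {B : ℕ}
    (h : ∀ s x, (body s x).steps ≤ B) (s : σ) :
    (loop body (List.finRange k) s).steps ≤ k * (B + 1) := by
  simpa using loop_steps_le h (List.finRange k) s

end Timed

section Folds

theorem foldl_or_eq {ι : Type} (q : ι → Bool) (l : List ι) (b : Bool) :
    l.foldl (fun b x => b || q x) b = (b || l.any q) := by
  induction l generalizing b with
  | nil => simp
  | cons x l ih => simp [ih, Bool.or_assoc]

theorem foldl_add_finRange {k : ℕ} {M : Type} [AddCommMonoid M] (g : Fin k → M) (a : M) :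
    (List.finRange k).foldl (fun s x => s + g x) a = a + ∑ x, g x := by
  rw [Fin.sum_univ_def]
  generalize List.finRange k = l
  induction l generalizing a with
  | nil => simp
  | cons x l ih => simp [ih, add_assoc]

theorem foldl_update_finRange {k : ℕ} {α : Type} (g B : Fin k → α) :
    (List.finRange k).foldl (fun B x => Function.update B x (g x)) B = g := by
  have key : ∀ (l : List (Fin k)) (B : Fin k → α) (x : Fin k), (x ∈ l ∨ B x = g x) →
      l.foldl (fun B x => Function.update B x (g x)) B x = g x := by
    intro l
    induction l with
    | nil => intro B x h; simpa using h
    | cons y l ih =>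
      intro B x h
      refine ih _ x ?_
      by_cases hxy : x = y
      · subst hxy
        exact Or.inr (Function.update_self ..)
      · dsimp only
        rw [Function.update_of_ne hxy]
        simpa [hxy] using h
  funext x
  exact key _ B x (Or.inl (List.mem_finRange x))

open Classical in
/-- One step in the search for the first element of maximum score. -/
noncomputable def argmaxStep {ι : Type} (skip : ι → Bool) (sc : ι → ℝ) (best : Option (ι × ℝ))
    (x : ι) : Option (ι × ℝ) :=
  if skip x then best
  else match best with
    | none => some (x, sc x)
    | some b => if b.2 < sc x then some (x, sc x) else some b

/-- The second conjunct, that the stored value never decreases, carries the induction. The third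
says that the stored number is the score of an admissible element, so the first makes that element a
maximizer. -/
theorem foldl_argmaxStep {ι : Type} (skip : ι → Bool) (sc : ι → ℝ) (l : List ι)
    (best : Option (ι × ℝ)) :
    (∀ x ∈ l, skip x = false → ∃ b ∈ l.foldl (argmaxStep skip sc) best, sc x ≤ b.2) ∧
    (∀ b ∈ best, ∃ b' ∈ l.foldl (argmaxStep skip sc) best, b.2 ≤ b'.2) ∧
    ∀ b ∈ l.foldl (argmaxStep skip sc) best,
      b ∈ best ∨ skip b.1 = false ∧ b.2 = sc b.1 := by
  induction l generalizing best with
  | nil => exact ⟨by simp, fun b hb => ⟨b, hb, le_rfl⟩, fun b hb => Or.inl hb⟩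
  | cons x l ih =>
    obtain ⟨h1, h2, h3⟩ := ih (argmaxStep skip sc best x)
    have s1 : skip x = false → ∃ b ∈ argmaxStep skip sc best x, sc x ≤ b.2 := by
      intro hx
      unfold argmaxStep
      cases best with
      | none => simp [hx]
      | some b =>
        by_cases hb : b.2 < sc x
        · simp [hx, hb]
        · simp only [hx, hb, Bool.false_eq_true, if_false]
          exact ⟨b, rfl, not_lt.1 hb⟩
    have s2 : ∀ b ∈ best, ∃ b' ∈ argmaxStep skip sc best x, b.2 ≤ b'.2 := by
      rintro b rfl
      unfold argmaxStep
      by_cases hx : skip x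
      · exact ⟨b, by simp [hx], le_rfl⟩
      · by_cases hb : b.2 < sc x
        · exact ⟨(x, sc x), by simp [hx, hb], hb.le⟩
        · exact ⟨b, by simp [hx, hb], le_rfl⟩
    have s3 : ∀ b ∈ argmaxStep skip sc best x,
        b ∈ best ∨ skip b.1 = false ∧ b.2 = sc b.1 := by
      intro b hb
      unfold argmaxStep at hb
      by_cases hx : skip x
      · exact Or.inl (by simpa [hx] using hb)
      · cases best with
        | none =>
          simp only [hx, Bool.false_eq_true, if_false, Option.mem_def, Option.some.injEq] at hb
          subst hb
          exact Or.inr ⟨by simpa using hx, rfl⟩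
        | some b₀ =>
          by_cases hb₀ : b₀.2 < sc x
          · simp only [hx, hb₀, Bool.false_eq_true, if_false, if_true, Option.mem_def,
              Option.some.injEq] at hb
            subst hb
            exact Or.inr ⟨by simpa using hx, rfl⟩
          · exact Or.inl (by simpa [hx, hb₀] using hb)
    refine ⟨fun y hy hskip => ?_, fun b hb => ?_, fun b hb => ?_⟩
    · rcases List.mem_cons.1 hy with rfl | hy
      · obtain ⟨b, hb, hle⟩ := s1 hskip
        obtain ⟨b', hb', hle'⟩ := h2 b hb
        exact ⟨b', hb', hle.trans hle'⟩
      · exact h1 y hy hskip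
    · obtain ⟨b₁, hb₁, hle⟩ := s2 b hb
      obtain ⟨b', hb', hle'⟩ := h2 b₁ hb₁
      exact ⟨b', hb', hle.trans hle'⟩
    · exact (h3 b hb).elim (s3 b) Or.inr

/-- The set with the given characteristic function. -/
def boolSet {k : ℕ} (B : Fin k → Bool) : Finset (Fin k) := {x | B x}

theorem mem_boolSet {k : ℕ} {B : Fin k → Bool} {x : Fin k} : x ∈ boolSet B ↔ B x = true := by
  simp [boolSet]

theorem boolSet_update {k : ℕ} (B : Fin k → Bool) (x : Fin k) :
    boolSet (Function.update B x true) = insert x (boolSet B) := by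
  ext y
  by_cases h : y = x
  · subst h
    simp [mem_boolSet]
  · simp [mem_boolSet, h]

end Folds

namespace Timed

theorem loop_val_or {k : ℕ} {body : Bool → Fin k → Timed Bool} {q : Fin k → Bool}
    (h : ∀ b x, (body b x).val = (b || q x)) :
    (loop body (List.finRange k) false).val = true ↔ ∃ x, q x = true := by
  rw [loop_val, show (fun b x => (body b x).val) = fun b x => b || q x from
    funext fun b => funext fun x => h b x, foldl_or_eq]
  simp

theorem loop_val_add {k : ℕ} {M : Type} [AddCommMonoid M] {body : M → Fin k → Timed M}
    (g : Fin k → M) (h : ∀ s x, (body s x).val = s + g x) (a : M) :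
    (loop body (List.finRange k) a).val = a + ∑ x, g x := by
  rw [loop_val, show (fun s x => (body s x).val) = fun s x => s + g x from
    funext fun s => funext fun x => h s x, foldl_add_finRange]

theorem loop_val_update {k : ℕ} {α : Type} {body : (Fin k → α) → Fin k → Timed (Fin k → α)}
    (g : Fin k → α) (h : ∀ B x, (body B x).val = Function.update B x (g x)) (B : Fin k → α) :
    (loop body (List.finRange k) B).val = g := by
  rw [loop_val, show (fun B x => (body B x).val) = fun B x => Function.update B x (g x) from
    funext fun B => funext fun x => h B x, foldl_update_finRange]

theorem copyWith_val {k : ℕ} {α : Type} (B : Fin k → α) (x : Fin k) (a : α) :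
    (copyWith B x a).val = Function.update B x a := rfl

end Timed

/-! ### The program computes a greedy tree -/

namespace ECD

open ASRData Timed

variable {m n : ℕ} (I : ECD m n)

theorem separatedProg_val (E : Fin n → Bool) (i j : Fin m) :
    (I.separatedProg E i j).val = true ↔ ∃ e ∈ boolSet E, ¬(e ∈ I.S j ↔ e ∈ I.S i) := by
  refine (loop_val_or (q := fun e => E e && (decide (e ∈ I.S i) != decide (e ∈ I.S j)))
    fun b e => ?_).trans (exists_congr fun e => ?_)
  · cases hE : E e <;> simp [bind_val, op_val, pure_val, readTest]
  · simp only [Bool.and_eq_true, bne_iff_ne, mem_boolSet, ne_eq, decide_eq_decide]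
    exact and_congr_right fun _ => not_congr iff_comm

theorem valueProg_val (E : Fin n → Bool) (i : Fin m) :
    (I.valueProg E i).val = I.toASR.f i (boolSet E) := by
  unfold valueProg
  -- Numerator and denominator are accumulated together, as one sum in `ℝ × ℝ`.
  rw [bind_val, op_val, loop_val_add (fun j : Fin m =>
    ((if j ∈ I.separated i (boolSet E) then (1 : ℝ) else 0),
      (if j ∈ (I.Q.part i)ᶜ then (1 : ℝ) else 0))), toASR_f]
  · simp [Prod.fst_sum, Prod.snd_sum, -mem_compl]
  · intro s j
    have hsep := I.separatedProg_val E i j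
    by_cases hj : j ∈ I.Q.part i
    · simp [bind_val, op_val, pure_val, readSame, hj, mem_separated]
    · cases hs : (I.separatedProg E i j).val
      · have : j ∉ I.separated i (boolSet E) := fun h => by
          simp [hsep.2 (I.mem_separated.1 h).2] at hs
        simp [bind_val, op_val, pure_val, readSame, hj, hs, this, Prod.ext_iff]
      · have : j ∈ I.separated i (boolSet E) := I.mem_separated.2 ⟨hj, hsep.1 hs⟩
        simp [bind_val, op_val, pure_val, readSame, hj, hs, this, Prod.ext_iff]

/-- The choice of the smaller side that the program makes; the yes-side is preferred. -/
noncomputable def lightSide (H : Finset (Fin m)) (e : Fin n) : Finset (Fin m) :=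
  if #(I.toASR.yesSide H e) ≤ #(I.toASR.noSide H e) then I.toASR.yesSide H e
  else I.toASR.noSide H e

theorem isLight_lightSide (H : Finset (Fin m)) (e : Fin n) :
    I.toASR.IsLight H e (I.lightSide H e) := by
  unfold lightSide
  split_ifs with h
  · exact ⟨Or.inl rfl, le_rfl, h⟩
  · exact ⟨Or.inr rfl, (not_le.1 h).le, le_rfl⟩

theorem mem_yesSide {H : Finset (Fin m)} {e : Fin n} {i : Fin m} :
    i ∈ I.toASR.yesSide H e ↔ i ∈ H ∧ e ∈ I.S i := mem_filter

theorem mem_noSide {H : Finset (Fin m)} {e : Fin n} {i : Fin m} :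
    i ∈ I.toASR.noSide H e ↔ i ∈ H ∧ e ∉ I.S i := mem_filter

theorem lightProg_val (H : Fin m → Bool) (e : Fin n) :
    (I.lightProg H e).val = ∑ j ∈ I.lightSide (boolSet H) e, I.p j := by
  unfold lightProg
  rw [bind_val, loop_val_add (fun i : Fin m =>
    (((if i ∈ I.toASR.yesSide (boolSet H) e then 1 else 0),
        (if i ∈ I.toASR.yesSide (boolSet H) e then I.p i else 0)),
      ((if i ∈ I.toASR.noSide (boolSet H) e then 1 else 0),
        (if i ∈ I.toASR.noSide (boolSet H) e then I.p i else 0))))]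
  · unfold lightSide
    simp only [bind_val, op_val, Prod.fst_add, Prod.snd_add, Prod.fst_sum, Prod.snd_sum, zero_add,
      decide_eq_true_eq, sum_ite_mem, univ_inter, sum_const, smul_eq_mul, mul_one]
    split_ifs <;> rfl
  · intro s i
    cases hH : H i
    · simp [bind_val, op_val, pure_val, Prod.ext_iff, mem_yesSide, mem_noSide, mem_boolSet, hH]
    · by_cases he : e ∈ I.S i <;>
        simp [bind_val, op_val, pure_val, readTest, he, Prod.ext_iff, mem_yesSide, mem_noSide,
          mem_boolSet, hH]

theorem scoreProg_val (E : Fin n → Bool) (H : Fin m → Bool) (e : Fin n) :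
    (I.scoreProg E H e).val =
      I.toASR.score (boolSet E) (boolSet H) (I.lightSide (boolSet H) e) e := by
  unfold scoreProg
  simp only [bind_val, op_val]
  rw [loop_val_add (fun i : Fin m => if i ∈ boolSet H then I.p i *
    ((I.toASR.f i (insert e (boolSet E)) - I.toASR.f i (boolSet E)) /
      (1 - I.toASR.f i (boolSet E))) else 0)]
  · rw [lightProg_val, zero_add, sum_ite_mem, univ_inter, div_eq_mul_one_div, mul_comm]
    rfl
  · intro g i
    cases hH : H i <;>
      simp [bind_val, op_val, pure_val, valueProg_val, copyWith_val, boolSet_update, mem_boolSet,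
        hH]

theorem selectProg_val (E : Fin n → Bool) (H : Fin m → Bool) :
    (I.selectProg E H).val = (List.finRange n).foldl
      (argmaxStep E fun e => (I.scoreProg E H e).val) none := by
  unfold selectProg
  rw [loop_val]
  congr 1
  funext best e
  unfold argmaxStep
  cases hE : E e
  · cases best with
    | none => simp [bind_val, op_val]
    | some b =>
      by_cases hb : b.2 < (I.scoreProg E H e).val <;> simp [bind_val, op_val, pure_val, hb]
  · simp [bind_val, op_val, pure_val]

theorem isGreedyChoice_of_selectProg {E : Fin n → Bool} {H : Fin m → Bool} {b : Fin n × ℝ}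
    (h : (I.selectProg E H).val = some b) :
    I.toASR.IsGreedyChoice (boolSet E) (boolSet H) b.1 := by
  obtain ⟨h1, -, h3⟩ := foldl_argmaxStep E (fun e => (I.scoreProg E H e).val) (List.finRange n) none
  rw [← selectProg_val, h] at h1 h3
  obtain ⟨hb, hval⟩ := (h3 b rfl).resolve_left (by simp)
  refine ⟨I.lightSide (boolSet H), fun e _ => I.isLight_lightSide _ e, ?_, fun e he => ?_⟩
  · rw [mem_boolSet, hb]
    exact Bool.false_ne_true
  · obtain ⟨b', hb', hle⟩ := h1 e (List.mem_finRange e) (by simpa [mem_boolSet] using he)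
    obtain rfl : b = b' := by simpa using hb'
    rwa [hval, scoreProg_val, scoreProg_val] at hle

theorem boolSet_eq_univ_of_selectProg {E : Fin n → Bool} {H : Fin m → Bool}
    (h : (I.selectProg E H).val = none) : boolSet E = univ := by
  obtain ⟨h1, -, -⟩ := foldl_argmaxStep E (fun e => (I.scoreProg E H e).val) (List.finRange n) none
  rw [← selectProg_val, h] at h1
  refine eq_univ_of_forall fun e => ?_
  rw [mem_boolSet]
  by_contra he
  obtain ⟨b, hb, -⟩ := h1 e (List.mem_finRange e) (by simpa using he)
  simp at hb

theorem updateProg_val (E : Fin n → Bool) (H : Fin m → Bool) (e : Fin n) (b : Bool) (i : Fin m) :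
    (I.updateProg E H e b).val i = true ↔
      (i ∈ boolSet H ∧ (e ∈ I.S i ↔ b = true)) ∧ I.toASR.f i (boolSet E) < 1 := by
  classical
  unfold updateProg
  rw [loop_val_update (fun i => H i && ((decide (e ∈ I.S i) == b) &&
    decide (I.toASR.f i (boolSet E) < 1)))]
  · rw [mem_boolSet]
    by_cases he : e ∈ I.S i <;> cases b <;> simp [he]
  · intro B x
    simp [bind_val, op_val, copyWith_val, valueProg_val, readTest]

theorem initProg_val (E : Fin n → Bool) (i : Fin m) :
    (I.initProg E).val i = true ↔ I.toASR.f i (boolSet E) < 1 := by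
  classical
  unfold initProg
  rw [bind_val, loop_val_update (fun i => decide (I.toASR.f i (boolSet E) < 1))]
  · simp
  · intro B x
    simp [bind_val, op_val, copyWith_val, valueProg_val]

theorem nonemptyProg_val (H : Fin m → Bool) :
    (nonemptyProg H).val = true ↔ (boolSet H).Nonempty :=
  (loop_val_or fun _ _ => rfl).trans (exists_congr fun _ => mem_boolSet.symm)

/-- The decision tree of the program, for at most the given number of rounds. -/
noncomputable def greedyTree : ℕ → (Fin n → Bool) → (Fin m → Bool) → DTree (Fin n)
  | 0, _, _ => .leaf
  | k + 1, E, H =>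
    if (nonemptyProg H).val then
      match (I.selectProg E H).val with
      | none => .leaf
      | some b =>
        .node b.1
          (greedyTree k (Function.update E b.1 true)
            (I.updateProg (Function.update E b.1 true) H b.1 true).val)
          (greedyTree k (Function.update E b.1 true)
            (I.updateProg (Function.update E b.1 true) H b.1 false).val)
    else .leaf

theorem roundsProg_val (i : Fin m) (k : ℕ) (E : Fin n → Bool) (H : Fin m → Bool) :
    (I.roundsProg (fun e => decide (e ∈ I.S i)) k E H).val =
      (I.greedyTree k E H).path (I.S i) := by
  induction k generalizing E H with
  | zero => rfl
  | succ k ih =>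
    unfold roundsProg greedyTree
    rw [bind_val]
    cases hH : (nonemptyProg H).val
    · rfl
    · simp only [if_true, bind_val]
      cases hs : (I.selectProg E H).val with
      | none => rfl
      | some b =>
        by_cases he : b.1 ∈ I.S i <;>
          simp [bind_val, op_val, copyWith_val, ih, DTree.path, he]

variable {I}

/-- Every round adds a new test, so `k` rounds suffice once `n ≤ k + #E`. When no test is left, all
hypotheses are covered and `H` is empty, so running out of rounds or tests is a legitimate stop. -/
theorem greedyFrom_greedyTree (hQ : 2 ≤ #I.Q.parts) (k : ℕ) (E : Fin n → Bool) (H : Fin m → Bool)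
    (hk : n ≤ k + #(boolSet E)) (hf : ∀ i ∈ boolSet H, I.toASR.f i (boolSet E) < 1) :
    I.toASR.GreedyFrom (boolSet E) (boolSet H) (I.greedyTree k E H) := by
  have hfull : ∀ (E : Fin n → Bool) (H : Fin m → Bool),
      (∀ i ∈ boolSet H, I.toASR.f i (boolSet E) < 1) → boolSet E = univ → boolSet H = ∅ := by
    intro E H hf hE
    refine eq_empty_of_forall_notMem fun i hi => ?_
    have := hf i hi
    rw [hE, (isInstance_toASR hQ).f_univ] at this
    exact lt_irrefl _ this
  induction k generalizing E H with
  | zero =>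
    have hE : boolSet E = univ := by
      rw [← card_eq_iff_eq_univ, Fintype.card_fin]
      have := card_le_univ (boolSet E)
      rw [Fintype.card_fin] at this
      omega
    rw [hfull E H hf hE]
    exact .finished _
  | succ k ih =>
    have hne := nonemptyProg_val H
    unfold greedyTree
    cases hH : (nonemptyProg H).val
    · rw [hH] at hne
      have hempty : boolSet H = ∅ := by simpa using hne
      rw [hempty]
      exact .finished _
    · simp only [if_true]
      cases hs : (I.selectProg E H).val with
      | none =>
        rw [hfull E H hf (I.boolSet_eq_univ_of_selectProg hs)]
        exact .finished _
      | some b =>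
        have hchoice := I.isGreedyChoice_of_selectProg hs
        have hb : b.1 ∉ boolSet E := by
          obtain ⟨_, -, hb, -⟩ := hchoice
          exact hb
        have hcard : n ≤ k + #(boolSet (Function.update E b.1 true)) := by
          rw [boolSet_update, card_insert_of_notMem hb]
          omega
        have hfnext : ∀ r, ∀ i ∈ boolSet (I.updateProg (Function.update E b.1 true) H b.1 r).val,
            I.toASR.f i (boolSet (Function.update E b.1 true)) < 1 := fun r i hi =>
          ((I.updateProg_val _ _ _ _ _).1 (mem_boolSet.1 hi)).2
        have hyes := ih _ _ hcard (hfnext true)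
        have hno := ih _ _ hcard (hfnext false)
        have eyes : boolSet (I.updateProg (Function.update E b.1 true) H b.1 true).val =
            I.toASR.uncovered (insert b.1 (boolSet E)) (I.toASR.yesSide (boolSet H) b.1) := by
          ext i
          rw [mem_boolSet, updateProg_val, mem_uncovered, boolSet_update]
          simp [mem_yesSide]
        have eno : boolSet (I.updateProg (Function.update E b.1 true) H b.1 false).val =
            I.toASR.uncovered (insert b.1 (boolSet E)) (I.toASR.noSide (boolSet H) b.1) := by
          ext i
          rw [mem_boolSet, updateProg_val, mem_uncovered, boolSet_update]
          simp [mem_noSide]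
        rw [eyes, boolSet_update] at hyes
        rw [eno, boolSet_update] at hno
        exact .display _ _ _ _ _ (hne.1 hH) hchoice hyes hno

theorem isGreedyTree_greedyTree (hQ : 2 ≤ #I.Q.parts) :
    I.toASR.IsGreedyTree (I.greedyTree n (fun _ => false) (I.initProg fun _ => false).val) := by
  have hE : boolSet (fun _ : Fin n => false) = ∅ := by simp [boolSet]
  have hH : boolSet (I.initProg fun _ => false).val = I.toASR.uncovered ∅ univ := by
    ext i
    rw [mem_boolSet, initProg_val, hE, mem_uncovered]
    simp
  have h := greedyFrom_greedyTree hQ n (fun _ => false) (I.initProg fun _ => false).val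
    (Nat.le_add_right _ _) fun i hi => (I.initProg_val _ i).1 (mem_boolSet.1 hi)
  rwa [hE, hH] at h

theorem greedyProg_val (i : Fin m) :
    (I.greedyProg fun e => decide (e ∈ I.S i)).val =
      (I.greedyTree n (fun _ => false) (I.initProg fun _ => false).val).path (I.S i) :=
  I.roundsProg_val i n _ _

end ECD

/-! ### Polynomial bound on the number of steps -/

namespace ECD

open ASRData Timed

variable {m n : ℕ} (I : ECD m n)

theorem copyWith_steps {k : ℕ} {α : Type} (B : Fin k → α) (x : Fin k) (a : α) :
    (copyWith B x a).steps = k + 1 := rfl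

theorem separatedProg_steps_le (E : Fin n → Bool) (i j : Fin m) :
    (I.separatedProg E i j).steps ≤ n * 6 := by
  refine loop_finRange_steps_le (fun s e => ?_) _
  cases hE : E e <;> simp [bind_steps, op_steps, op_val, pure_steps, readTest]

theorem valueProg_steps_le (E : Fin n → Bool) (i : Fin m) :
    (I.valueProg E i).steps ≤ m * (n * 6 + 4) + 1 := by
  unfold valueProg
  rw [bind_steps, op_steps]
  refine Nat.add_le_add_right (loop_finRange_steps_le (fun s j => ?_) _) 1
  have h := I.separatedProg_steps_le E i j
  by_cases hj : j ∈ I.Q.part i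
  · simp [bind_steps, op_steps, op_val, pure_steps, readSame, hj]
  · cases hs : (I.separatedProg E i j).val <;>
      simp [bind_steps, op_steps, op_val, pure_steps, readSame, hj, hs] <;> omega

theorem lightProg_steps_le (H : Fin m → Bool) (e : Fin n) :
    (I.lightProg H e).steps ≤ m * 6 + 1 := by
  unfold lightProg
  rw [bind_steps]
  refine Nat.add_le_add (loop_finRange_steps_le (fun s i => ?_) _) ?_
  · cases hH : H i
    · simp [bind_steps, op_steps, op_val, pure_steps]
    · by_cases he : e ∈ I.S i <;>
        simp [bind_steps, op_steps, op_val, pure_steps, readTest, he]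
  · simp only [bind_steps, op_steps]
    split_ifs <;> simp [pure_steps]

theorem scoreProg_steps_le (E : Fin n → Bool) (H : Fin m → Bool) (e : Fin n) :
    (I.scoreProg E H e).steps ≤
      (m * 6 + 1) + ((n + 1) + (m * (2 * (m * (n * 6 + 4) + 1) + 7 + 1) + 3)) := by
  unfold scoreProg
  simp only [bind_steps, op_steps]
  refine Nat.add_le_add (I.lightProg_steps_le H e) (Nat.add_le_add le_rfl
    (Nat.add_le_add (loop_finRange_steps_le (fun g i => ?_) _) (by norm_num)))
  have h1 := I.valueProg_steps_le E i
  have h2 := I.valueProg_steps_le (copyWith E e true).val i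
  cases hH : H i
  · simp [bind_steps, op_steps, op_val, pure_steps]
  · simp [bind_steps, op_steps, op_val]
    omega

theorem selectProg_steps_le {B : ℕ} (E : Fin n → Bool) (H : Fin m → Bool)
    (hB : ∀ e, (I.scoreProg E H e).steps ≤ B) : (I.selectProg E H).steps ≤ n * (B + 3 + 1) := by
  refine loop_finRange_steps_le (fun best e => ?_) _
  have h := hB e
  cases hE : E e
  · cases best with
    | none =>
      simp [bind_steps, op_steps, op_val]
      omega
    | some b =>
      by_cases hb : b.2 < (I.scoreProg E H e).val <;>
        simp only [bind_steps, op_steps, op_val, pure_steps, hb, Bool.false_eq_true, if_false,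
          decide_true, decide_false, if_true]
      all_goals omega
  · simp [bind_steps, op_steps, op_val, pure_steps]

theorem updateProg_steps_le {V : ℕ} (E : Fin n → Bool) (H : Fin m → Bool) (e : Fin n) (b : Bool)
    (hV : ∀ i, (I.valueProg E i).steps ≤ V) :
    (I.updateProg E H e b).steps ≤ m * (V + m + 7 + 1) := by
  refine loop_finRange_steps_le (fun H' i => ?_) _
  have := hV i
  simp only [bind_steps, op_steps, copyWith_steps, readTest]
  omega

theorem initProg_steps_le {V : ℕ} (E : Fin n → Bool) (hV : ∀ i, (I.valueProg E i).steps ≤ V) :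
    (I.initProg E).steps ≤ m + m * (V + m + 2 + 1) := by
  unfold initProg
  rw [bind_steps]
  refine Nat.add_le_add le_rfl (loop_finRange_steps_le (fun H' i => ?_) _)
  have := hV i
  simp only [bind_steps, op_steps, copyWith_steps]
  omega

theorem nonemptyProg_steps_le (H : Fin m → Bool) : (nonemptyProg H).steps ≤ m * 3 :=
  loop_finRange_steps_le (B := 2) (fun _ _ => le_rfl) _

theorem roundsProg_steps_le {S V : ℕ} (result : Fin n → Bool)
    (hS : ∀ E H, (I.selectProg E H).steps ≤ S)
    (hV : ∀ E H e b, (I.updateProg E H e b).steps ≤ V) (k : ℕ) (E : Fin n → Bool)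
    (H : Fin m → Bool) :
    (I.roundsProg result k E H).steps ≤ k * (m * 3 + S + V + n + 3) := by
  induction k generalizing E H with
  | zero => simp [roundsProg, pure_steps]
  | succ k ih =>
    have h1 := nonemptyProg_steps_le H
    have h2 := hS E H
    rw [Nat.succ_mul]
    unfold roundsProg
    rw [bind_steps]
    cases hH : (nonemptyProg H).val
    · simp only [Bool.false_eq_true, if_false, pure_steps]
      omega
    · simp only [if_true]
      rw [bind_steps]
      cases hs : (I.selectProg E H).val with
      | none =>
        simp only [pure_steps]
        omega
      | some b =>
        have h3 := hV (copyWith E b.1 true).val H b.1 (result b.1)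
        have h4 := ih (copyWith E b.1 true).val
          (I.updateProg (copyWith E b.1 true).val H b.1 (result b.1)).val
        simp only [bind_steps, op_steps, op_val, copyWith_steps]
        omega

theorem greedyProg_steps_le (hN : 1 ≤ m + n) (result : Fin n → Bool) :
    (I.greedyProg result).steps ≤ 100 * (m + n) ^ 5 := by
  obtain ⟨N, hNdef⟩ : ∃ N, N = m + n := ⟨_, rfl⟩
  have hm : m ≤ N := by omega
  have hn : n ≤ N := by omega
  have h1 : 1 ≤ N := by omega
  -- Lower powers are absorbed into the highest one, so each constant below is the sum of the
  -- coefficients. The total is `1 + 16 + 73 = 90`.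
  have p1 : N ≤ N ^ 2 := Nat.le_self_pow (by norm_num) N
  have p2 : N ^ 2 ≤ N ^ 3 := Nat.pow_le_pow_right h1 (by norm_num)
  have p3 : N ^ 3 ≤ N ^ 4 := Nat.pow_le_pow_right h1 (by norm_num)
  have p4 : N ^ 4 ≤ N ^ 5 := Nat.pow_le_pow_right h1 (by norm_num)
  have hV0 : m * (n * 6 + 4) + 1 ≤ 11 * N ^ 2 := by
    calc m * (n * 6 + 4) + 1 ≤ N * (N * 6 + 4) + 1 := by gcongr
      _ ≤ 11 * N ^ 2 := by linarith
  have hV : ∀ E i, (I.valueProg E i).steps ≤ 11 * N ^ 2 := fun E i =>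
    (I.valueProg_steps_le E i).trans hV0
  have hsc : ∀ E H e, (I.scoreProg E H e).steps ≤ 42 * N ^ 3 := fun E H e => by
    refine (I.scoreProg_steps_le E H e).trans ?_
    calc (m * 6 + 1) + ((n + 1) + (m * (2 * (m * (n * 6 + 4) + 1) + 7 + 1) + 3))
        ≤ (N * 6 + 1) + ((N + 1) + (N * (2 * (11 * N ^ 2) + 7 + 1) + 3)) := by gcongr
      _ ≤ 42 * N ^ 3 := by linarith
  have hS : ∀ E H, (I.selectProg E H).steps ≤ 46 * N ^ 4 := fun E H => by
    refine (I.selectProg_steps_le E H (hsc E H)).trans ?_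
    calc n * (42 * N ^ 3 + 3 + 1) ≤ N * (42 * N ^ 3 + 3 + 1) := by gcongr
      _ ≤ 46 * N ^ 4 := by linarith
  have hU : ∀ E H e b, (I.updateProg E H e b).steps ≤ 20 * N ^ 3 := fun E H e b => by
    refine (I.updateProg_steps_le E H e b (hV E)).trans ?_
    calc m * (11 * N ^ 2 + m + 7 + 1) ≤ N * (11 * N ^ 2 + N + 7 + 1) := by gcongr
      _ ≤ 20 * N ^ 3 := by linarith
  have hI : ∀ E, (I.initProg E).steps ≤ 16 * N ^ 3 := fun E => by
    refine (I.initProg_steps_le E (hV E)).trans ?_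
    calc m + m * (11 * N ^ 2 + m + 2 + 1) ≤ N + N * (11 * N ^ 2 + N + 2 + 1) := by gcongr
      _ ≤ 16 * N ^ 3 := by linarith
  have hR : ∀ E H, (I.roundsProg result n E H).steps ≤ 73 * N ^ 5 := fun E H => by
    refine (I.roundsProg_steps_le result hS hU n E H).trans ?_
    calc n * (m * 3 + 46 * N ^ 4 + 20 * N ^ 3 + n + 3)
        ≤ N * (N * 3 + 46 * N ^ 4 + 20 * N ^ 3 + N + 3) := by gcongr
      _ ≤ 73 * N ^ 5 := by linarith
  rw [← hNdef]
  unfold greedyProg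
  simp only [bind_steps]
  have e1 := hI (newArray n false).val
  have e2 := hR (newArray n false).val (I.initProg (newArray n false).val).val
  have e3 : (newArray n false).steps = n := rfl
  linarith

end ECD

end AdaptiveRanking

theorem mainTheorem6 :
    ∃ C K : ℝ, ∃ d : ℕ, 0 < C ∧ 0 < K ∧
      ∀ (m n : ℕ) (I : AdaptiveRanking.ECD m n), 2 ≤ I.Q.parts.card →
        I.toASR.IsInstance ∧
        (∀ (i : Fin m) (X : Finset (Fin n)), I.toASR.f i X = 1 ↔ I.Recognized i X) ∧
        (∀ T : AdaptiveRanking.DTree (Fin n), I.toASR.IsGreedyTree T →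
          I.Feasible T ∧
          ∀ T' : AdaptiveRanking.DTree (Fin n), I.Feasible T' →
            I.expectedCost T ≤ C * Real.log m * I.expectedCost T') ∧
        (∃ T : AdaptiveRanking.DTree (Fin n), I.toASR.IsGreedyTree T ∧
          ∀ i : Fin m,
            (I.greedyProg fun e => decide (e ∈ I.S i)).val = T.path (I.S i) ∧
            ((I.greedyProg fun e => decide (e ∈ I.S i)).steps : ℝ) ≤ K * ((m : ℝ) + n) ^ d) := by
  refine ⟨20, 100, 5, by norm_num, by norm_num, fun m n I hQ => ⟨?_, ?_, ?_, ?_⟩⟩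
  · exact AdaptiveRanking.ECD.isInstance_toASR hQ
  · exact AdaptiveRanking.ECD.toASR_f_eq_one_iff hQ
  · exact fun T hT => ⟨AdaptiveRanking.ECD.feasible_of_isGreedyTree hQ hT,
      fun T' hT' => AdaptiveRanking.ECD.expectedCost_greedy_le_log hQ hT hT'⟩
  · refine ⟨_, AdaptiveRanking.ECD.isGreedyTree_greedyTree hQ, fun i => ⟨I.greedyProg_val i, ?_⟩⟩
    have hm := AdaptiveRanking.ECD.two_le_card hQ
    exact_mod_cast I.greedyProg_steps_le (by omega) fun e => decide (e ∈ I.S i)
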